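/- **Theorem.** Let $T$ be a finite alphabet. For a language $\mathcal L$ over $T$, let $\mathcal L_n$ be its set of words of length $n$. A *uniform generator* of $\mathcal L_n$ is a random procedure that outputs each word of $\mathcal L_n$ with probability $1/|\mathcal L_n|$, after a (random) number of elementary steps. Given $\mathcal F\subset\mathcal L_n$ and $k$, the *rejection approach* makes independent runs of such a generator until $k$ distinct words outside $\mathcal F$ have been obtained. Its running time is the sum, over the runs made, of the number of steps of the run plus the length $n$ of the drawn word (the time to compare it, in a prefix tree, with $\mathcal F$ and the words already obtained). Its average-case complexity is the expectation of this running time. 1. Let $\mathcal L$ be the language of an unambiguous context-free grammar in Chomsky normal form, each nonterminal having productions $A\to BC$, or $A\to B\mid C$, or $A\to t$, and the start symbol possibly deriving the empty word if it appears in no right-hand side. The rejection approach uses the recursive generator: from a nonterminal and a length, it chooses one alternative of a union, or the length of the first factor of a product (positions being tried in the order $1,m-1,2,m-2,\dots$), with probabilities proportional to the numbers of words of the alternatives. Each random test compares fair coin flips with the binary digits of the required probability until the first disagreement. These digits, which depend only on the grammar and the length, are tabulated beforehand and this precomputation is not counted. Visiting a nonterminal with length $m$ costs the bit length of $m$, and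 reading the first $c$ digits of a probability in the table for length $m$ costs $c\cdot(\text{bit length of } m + c)$. Then, for each $n\ge1$, this is a uniform generator of $\mathcal L_n$; and for every $\varepsilon>0$ its average time per word is $O(n^{1+\varepsilon})$, for $n\geq 1$ with $\mathcal L_n\ne\emptyset$, and there is a constant $K$ depending only on the grammar and $\varepsilon$ such that for all $n\ge1$, all $\mathcal F\subset\mathcal L_n$ and all $k\ge2$ with $k\le|\mathcal L_n|-|\mathcal F|$, the average-case complexity of the rejection approach is at most $$K\,\frac{|\mathcal L_n|}{|\mathcal L_n|-|\mathcal F|}\;n^{1+\varepsilon}\;k\log k .$$ 2. Let $\mathcal L$ be any context-free language, let $\varepsilon>0$, and let the rejection approach use any family of uniform generators of the sets $\mathcal L_n$, $n\ge1$, whose average time per word is $O(n^{1+\varepsilon})$ (for $\mathcal L_n\neq\emptyset$). Then the same bound holds, for all $n\ge1$, all $\mathcal F\subset\mathcal L_n$ and all $k\ge2$ with $k\le|\mathcal L_n|-|\mathcal F|$, with a constant $K$ depending only on $\mathcal L$, $\varepsilon$ and the generators. -/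

import Mathlib

open MeasureTheory
open scoped ENNReal

noncomputable section

/-! ### Uniform generators and the rejection approach -/

/-- The words of length `n` of a language. -/
def sizeSlice {T : Type*} (L : Language T) (n : ℕ) : Set (List T) :=
  {w | w ∈ L ∧ w.length = n}

/-- The outcome of one run of a random generator: the word that was drawn, and the number of
elementary steps (time) that the run took. -/
structure Draw (T : Type*) where
  word : List T
  steps : ℕ

instance {T : Type*} : MeasurableSpace (Draw T) := ⊤

instance {T : Type*} : DiscreteMeasurableSpace (Draw T) := ⟨fun _ => trivial⟩

/-- The random generator with joint law `p` of (word, time) draws uniformly from the finite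
set `S`.  (For nonempty `S` these probabilities add up to one, so nothing else is drawn.) -/
def IsUniformGenerator {T : Type*} (p : PMF (Draw T)) (S : Set (List T)) : Prop :=
  ∀ w ∈ S, (p.map Draw.word) w = (S.ncard : ℝ≥0∞)⁻¹

/-- Average time of one draw. -/
def meanSteps {T : Type*} (p : PMF (Draw T)) : ℝ≥0∞ :=
  ∑' d, p d * (d.steps : ℝ≥0∞)

open Classical in
/-- The distinct words outside `F` found among the first `t` draws `ω 0, …, ω (t - 1)`. -/
def accepted {T : Type*} (F : Finset (List T)) (ω : ℕ → Draw T) (t : ℕ) : Finset (List T) :=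
  ((Finset.range t).image fun j => (ω j).word) \ F

/-- Running time of the rejection approach on the sequence of draws `ω`: words are drawn until `k`
distinct words outside `F` have been obtained, so the draw `ω t` is made exactly when the draws
before it have not yet produced `k` such words.  Each draw that is made is charged its own
generation time, plus the length of the drawn word for comparing it, in a prefix tree, with the
forbidden words and the words already obtained. -/
def rejectionTime {T : Type*} (F : Finset (List T)) (k : ℕ) (ω : ℕ → Draw T) : ℝ≥0∞ :=
  ∑' t, if (accepted F ω t).card < k then
    (((ω t).steps + (ω t).word.length : ℕ) : ℝ≥0∞) else 0

/-- Average-case complexity of the rejection approach: the expectation of its running time when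
the draws are independent runs of the generator `p`. -/
def rejectionCost {T : Type*} (p : PMF (Draw T)) (F : Finset (List T)) (k : ℕ) : ℝ≥0∞ :=
  ∫⁻ ω, rejectionTime F k ω ∂(Measure.infinitePi fun _ : ℕ => p.toMeasure)

/-! ### Context-free grammars in Chomsky normal form -/

/-- The productions attached to one nonterminal: a product `A → B C`, a union `A → B | C`, or a
terminal `A → t`. -/
inductive CNFRule (T : Type*) (N : Type)
  | prod (B C : N)
  | union (B C : N)
  | term (t : T)

/-- The right-hand sides of these productions. -/
def CNFRule.outputs {T : Type*} {N : Type} : CNFRule T N → List (List (Symbol T N))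
  | .prod B C => [[.nonterminal B, .nonterminal C]]
  | .union B C => [[.nonterminal B], [.nonterminal C]]
  | .term t => [[.terminal t]]

/-- A context-free grammar in Chomsky normal form.  The start symbol may derive the empty word
(`nullable`) only if it appears in no right-hand side. -/
structure CNFGrammar (T : Type*) where
  NT : Type
  [fintypeNT : Fintype NT]
  start : NT
  rule : NT → CNFRule T NT
  nullable : Prop
  start_not_mem : nullable → ∀ A, ∀ o ∈ (rule A).outputs, Symbol.nonterminal start ∉ o

attribute [instance] CNFGrammar.fintypeNT

namespace CNFGrammar

variable {T : Type*} (g : CNFGrammar T)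

open Classical in
/-- The underlying context-free grammar. -/
def toCFG : ContextFreeGrammar T where
  NT := g.NT
  initial := g.start
  rules := (Finset.univ.biUnion fun A =>
      ((g.rule A).outputs.map fun o => (⟨A, o⟩ : ContextFreeRule T g.NT)).toFinset) ∪
    if g.nullable then {⟨g.start, []⟩} else ∅

/-- The language of the grammar. -/
def language : Language T := g.toCFG.language

/-- The language associated with the nonterminal `A`. -/
def languageOf (A : g.NT) : Language T :=
  ({ g.toCFG with initial := A } : ContextFreeGrammar T).language

/-- The number of words of length `m` associated with the nonterminal `A`. -/
def count (A : g.NT) (m : ℕ) : ℕ := (sizeSlice (g.languageOf A) m).ncard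

end CNFGrammar

/-- Trees whose nodes are labelled by nonterminals, with a terminal below each leaf. -/
inductive ParseTree (T : Type*) (N : Type)
  | leaf (A : N) (t : T)
  | unit (A : N) (s : ParseTree T N)
  | node (A : N) (l r : ParseTree T N)

namespace ParseTree

variable {T : Type*} {N : Type}

def root : ParseTree T N → N
  | leaf A _ => A
  | unit A _ => A
  | node A _ _ => A

/-- The word read at the leaves, from left to right. -/
def yield : ParseTree T N → List T
  | leaf _ t => [t]
  | unit _ s => s.yield
  | node _ l r => l.yield ++ r.yield

end ParseTree

namespace CNFGrammar

variable {T : Type*} (g : CNFGrammar T)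

/-- Every node of the tree is an instance of a production of the grammar. -/
def IsParseTree : ParseTree T g.NT → Prop
  | .leaf A t => g.rule A = .term t
  | .unit A s => (∃ B C, g.rule A = .union B C ∧ (s.root = B ∨ s.root = C)) ∧ IsParseTree s
  | .node A l r => g.rule A = .prod l.root r.root ∧ IsParseTree l ∧ IsParseTree r

/-- The grammar is unambiguous: a word has at most one parse tree, that is at most one
derivation from the start symbol in which the leftmost nonterminal is always the one rewritten.
(The empty word has no parse tree in this sense; if it is generated at all, this is by the single
production that rewrites the start symbol to it.) -/
def Unambiguous : Prop :=
  ∀ s s' : ParseTree T g.NT, g.IsParseTree s → g.IsParseTree s' →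
    s.root = g.start → s'.root = g.start → s.yield = s'.yield → s = s'

end CNFGrammar

/-! ### The recursive uniform generator, with its bit cost

All randomness comes from fair coin flips.  The probabilities used by the generator depend on the
grammar and on the lengths only; the digits of their binary expansions are tabulated before the
generation. -/

/-- The number of agreements before the first disagreement between a sequence of fair coin flips
and a fixed sequence of bits. -/
def agreements : PMF ℕ :=
  ⟨fun j => (2⁻¹ : ℝ≥0∞) ^ (j + 1), by
    have h : ∑' j : ℕ, (2⁻¹ : ℝ≥0∞) ^ (j + 1) = 1 := by
      rw [ENNReal.tsum_geometric_add_one, ENNReal.one_sub_inv_two, inv_inv,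
        ENNReal.inv_mul_cancel (by simp) (by simp)]
    exact h ▸ ENNReal.summable.hasSum⟩

/-- A random test that succeeds with probability `a / b` (always, if `b ≤ a`): coins are flipped
one after the other and compared with the binary digits of `a / b`, until the first disagreement;
the test succeeds if the digit is then `1` (and the coin `0`), that is, if the real number whose
digits are the coins is below `a / b`.  The digit number `c ≥ 1` is `⌊2 ^ c * a / b⌋ mod 2`.  The
outcome comes with the number of digits that were read. -/
def coinTest (a b : ℕ) : PMF (Bool × ℕ) :=
  if b ≤ a then PMF.pure (true, 1)
  else agreements.map fun j => (decide ((2 ^ (j + 1) * a / b) % 2 = 1), j + 1)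

/-- Cost of reading the first `c` digits of a tabulated probability that belongs to the length `m`.
Each access is charged `Nat.size m + c`, which bounds the bit length of the address of the digit
in the table up to a constant factor that depends only on the grammar. -/
def readCost (m c : ℕ) : ℕ := c * (Nat.size m + c)

/-- Random choice of an element `i` of a list with probability proportional to `wt i`: the elements
are tried one after the other, in the order of the list, each with its probability given that the
elements before it have failed.  The choice comes with its cost, for tables of length `m`. -/
def pick (m : ℕ) (wt : ℕ → ℕ) : List ℕ → PMF (ℕ × ℕ)
  | [] => PMF.pure (0, 0)
  | i :: is => (coinTest (wt i) ((i :: is).map wt).sum).bind fun x =>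
      if x.1 then PMF.pure (i, readCost m x.2)
      else (pick m wt is).map fun y => (y.1, readCost m x.2 + y.2)

/-- The boustrophedon order `1, m - 1, 2, m - 2, …` on the splitting positions `1, …, m - 1`. -/
def boustrophedon (m : ℕ) : List ℕ :=
  (List.range (m - 1)).map fun j => if j % 2 = 0 then j / 2 + 1 else m - 1 - j / 2

namespace CNFGrammar

variable {T : Type*} (g : CNFGrammar T)

/-- The recursive generator of words of length `m` from the nonterminal `A`: a union chooses one of
its two nonterminals, a product chooses the length `i` of its first factor, in both cases with
probabilities proportional to the numbers of words of the alternatives.  Visiting a nonterminal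
costs `Nat.size m` in addition to the cost of the choice.  The first argument bounds the depth of
the recursion. -/
def generateFrom : ℕ → g.NT → ℕ → PMF (Draw T)
  | 0, _, _ => PMF.pure ⟨[], 0⟩
  | depth + 1, A, m =>
    match g.rule A with
    | .term t => PMF.pure ⟨[t], Nat.size m⟩
    | .union B C =>
      (coinTest (g.count B m) (g.count B m + g.count C m)).bind fun x =>
        (generateFrom depth (if x.1 then B else C) m).map fun d =>
          ⟨d.word, Nat.size m + readCost m x.2 + d.steps⟩
    | .prod B C =>
      (pick m (fun i => g.count B i * g.count C (m - i)) (boustrophedon m)).bind fun x =>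
        (generateFrom depth B x.1).bind fun d =>
          (generateFrom depth C (m - x.1)).map fun e =>
            ⟨d.word ++ e.word, Nat.size m + x.2 + d.steps + e.steps⟩

/-- The generator of words of length `n ≥ 1` of the grammar.  On a path of a parse tree of an
unambiguous grammar no nonterminal repeats with the same length, so that the depth allowed here is
never exceeded. -/
def generator (n : ℕ) : PMF (Draw T) :=
  g.generateFrom ((n + 1) * (Fintype.card g.NT + 1)) g.start n

end CNFGrammar

end

/-!
Both parts reduce to a statement about an arbitrary language and an arbitrary uniform generator of
its slices. The rejection approach decides to make a draw on the strength of the preceding draws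
only, so by Wald's identity (`rejectionCost_eq`) its mean cost is the mean cost of one draw, word
length included, times the expected number of draws. The latter is a coupon collector's problem:
with `N` words of which `M` are not forbidden, a draw made when `c` words have been accepted brings
a new one with probability at least `(M - c) / N`, so the potential `∑ i ∈ [c, k), N / (M - i)`
decreases by at least one on average with every draw that is made
(`IsUniformGenerator.expect_couponBound`). Its initial value is at most `(N / M) * k * H_k`, by
comparison with a harmonic sum.

For the recursive generator, uniformity needs only the lower bound: a word of length `m` is drawn
from `A` with probability at least the inverse of the number of such words
(`CNFGrammar.UnambiguousAt.inv_count_le_expect`), and lower bounds that add up to one are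
equalities. The lower bound follows by induction along the parse tree of the word, since
unambiguity makes the numbers of words of distinct alternatives add up to at most that of `A`, and is
inherited by every nonterminal that is visited. It also forbids that a nonterminal comes back along
unit productions, which bounds the height of the parse trees, and so the depth of the recursion.

For the mean time, a random test reads at most two digits on average, for any probability, so it costs
at most `8 * L` on average, where `L` is the bit length of `n`. The number of tests of a product of
length `m` split at `i` is at most `2 * min i (m - i)`, and the function `m * size m` satisfies
`φ i + φ (m - i) + min i (m - i) ≤ φ m`. By induction on the depth the mean time is therefore
`O(L * n * L)` (`CNFGrammar.UnambiguousAt.meanSteps_le`), which is `O(n ^ (1 + ε))`. The induction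
uses the unconditional cost of the tests, weighted by the probability that they are made: given its
outcome, a test may well be expensive.
-/

/-! ### Expectations over discrete laws -/

namespace PMF

variable {α β : Type*}

/-- The expectation of a nonnegative function under a discrete law, as a sum. -/
noncomputable def expect (p : PMF α) (f : α → ℝ≥0∞) : ℝ≥0∞ := ∑' a, p a * f a

theorem expect_pure (a : α) (f : α → ℝ≥0∞) : (PMF.pure a).expect f = f a := by
  rw [expect, tsum_eq_single a]
  · simp
  · intro b hb
    simp [PMF.pure_apply, hb]

theorem expect_bind (p : PMF α) (q : α → PMF β) (f : β → ℝ≥0∞) :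
    (p.bind q).expect f = p.expect fun a => (q a).expect f := by
  simp only [expect, PMF.bind_apply, ← ENNReal.tsum_mul_right, ← ENNReal.tsum_mul_left]
  rw [ENNReal.tsum_comm]
  simp only [mul_assoc]

theorem expect_map (p : PMF α) (h : α → β) (f : β → ℝ≥0∞) :
    (p.map h).expect f = p.expect fun a => f (h a) := by
  rw [← PMF.bind_pure_comp, expect_bind]
  simp only [Function.comp, expect_pure]

theorem expect_add (p : PMF α) (f h : α → ℝ≥0∞) :
    (p.expect fun a => f a + h a) = p.expect f + p.expect h := by
  simp only [expect, mul_add, ENNReal.tsum_add]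

theorem expect_mul_left (p : PMF α) (c : ℝ≥0∞) (f : α → ℝ≥0∞) :
    (p.expect fun a => c * f a) = c * p.expect f := by
  simp only [expect, ← ENNReal.tsum_mul_left]
  exact tsum_congr fun a => by ring

theorem expect_const (p : PMF α) (c : ℝ≥0∞) : (p.expect fun _ => c) = c := by
  simp only [expect, ENNReal.tsum_mul_right, p.tsum_coe, one_mul]

theorem expect_mono (p : PMF α) {f h : α → ℝ≥0∞} (H : ∀ a, p a ≠ 0 → f a ≤ h a) :
    p.expect f ≤ p.expect h := by
  refine ENNReal.tsum_le_tsum fun a => ?_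
  by_cases ha : p a = 0
  · simp [ha]
  · gcongr
    exact H a ha

theorem expect_congr (p : PMF α) {f h : α → ℝ≥0∞} (H : ∀ a, p a ≠ 0 → f a = h a) :
    p.expect f = p.expect h :=
  le_antisymm (p.expect_mono fun a ha => (H a ha).le) (p.expect_mono fun a ha => (H a ha).ge)

theorem lintegral_toMeasure [MeasurableSpace α] [MeasurableSingletonClass α] [Countable α]
    (p : PMF α) (f : α → ℝ≥0∞) : ∫⁻ a, f a ∂p.toMeasure = p.expect f := by
  rw [lintegral_countable', expect]
  refine tsum_congr fun a => ?_
  rw [p.toMeasure_apply_singleton a (measurableSet_singleton a), mul_comm]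

end PMF

/-! ### The rejection approach: independence and the coupon collector -/

section Rejection

variable {T : Type*}

theorem meanSteps_eq_expect (p : PMF (Draw T)) :
    meanSteps p = p.expect fun d => (d.steps : ℝ≥0∞) := rfl

theorem Draw.word_steps_injective :
    Function.Injective fun d : Draw T => (d.word, d.steps) := by
  rintro ⟨w, s⟩ ⟨w', s'⟩ h
  simpa using h

instance [Countable T] : Countable (Draw T) := Draw.word_steps_injective.countable

theorem accepted_zero (F : Finset (List T)) (ω : ℕ → Draw T) : accepted F ω 0 = ∅ := by
  simp [accepted]

open Classical in
theorem accepted_succ (F : Finset (List T)) (ω : ℕ → Draw T) (t : ℕ) :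
    accepted F ω (t + 1) = accepted F ω t ∪ ({(ω t).word} \ F) := by
  ext w
  simp only [accepted, Finset.mem_sdiff, Finset.mem_image, Finset.mem_range, Finset.mem_union,
    Finset.mem_singleton, Order.lt_add_one_iff, le_iff_lt_or_eq]
  grind

theorem measurable_apply_accepted [Countable T] (F : Finset (List T)) (t : ℕ) {β : Type*}
    [MeasurableSpace β] (f : Finset (List T) → Draw T → β) :
    Measurable fun ω : ℕ → Draw T => f (accepted F ω t) (ω t) := by
  classical
  have h : (fun ω : ℕ → Draw T => f (accepted F ω t) (ω t)) =
      (fun x : (Finset.range (t + 1)) → Draw T =>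
        f (((Finset.univ : Finset (Finset.range t)).image
          fun (j : Finset.range t) =>
            (x ⟨j, Finset.mem_range.2 ((Finset.mem_range.1 j.2).trans t.lt_succ_self)⟩).word) \ F)
          (x ⟨t, by simp⟩)) ∘ fun ω i => ω i := by
    funext ω
    simp only [Function.comp]
    congr 1
    ext w
    simp only [accepted, Finset.mem_sdiff, Finset.mem_image, Finset.mem_range,
      Finset.mem_univ, true_and, Subtype.exists]
    grind
  rw [h]
  exact (measurable_of_countable _).comp (by fun_prop)

/-- The words accepted before the draw number `t` are independent of that draw. -/
theorem lintegral_apply_accepted [Countable T] (p : PMF (Draw T)) (F : Finset (List T)) (t : ℕ)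
    (f : Finset (List T) → Draw T → ℝ≥0∞) :
    ∫⁻ ω, f (accepted F ω t) (ω t) ∂(Measure.infinitePi fun _ : ℕ => p.toMeasure) =
      ∫⁻ ω, p.expect (f (accepted F ω t)) ∂(Measure.infinitePi fun _ : ℕ => p.toMeasure) := by
  classical
  set μ := Measure.infinitePi fun _ : ℕ => p.toMeasure with hμ
  let _ : MeasurableSpace (Finset (List T)) := ⊤
  have : DiscreteMeasurableSpace (Finset (List T)) := ⟨fun _ => trivial⟩
  have hX : Measurable fun ω : ℕ → Draw T => accepted F ω t :=
    measurable_apply_accepted F t fun X _ => X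
  have hY : Measurable fun ω : ℕ → Draw T => ω t := measurable_pi_apply t
  have hind : ProbabilityTheory.iIndepFun (fun (i : ℕ) (ω : ℕ → Draw T) => ω i) μ :=
    ProbabilityTheory.iIndepFun_infinitePi (X := fun _ d => d) fun _ => measurable_id
  have hind2 : ProbabilityTheory.IndepFun (fun ω : ℕ → Draw T => accepted F ω t)
      (fun ω => ω t) μ := by
    have h := hind.indepFun_finset (Finset.range t) {t} (by simp) fun i => measurable_pi_apply i
    have h2 := h.comp
      (φ := fun x : (Finset.range t) → Draw T =>
        ((Finset.univ : Finset (Finset.range t)).image fun j => (x j).word) \ F)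
      (ψ := fun x : (({t} : Finset ℕ)) → Draw T => x ⟨t, by simp⟩)
      (measurable_of_countable _) (measurable_of_countable _)
    convert h2 using 1
    swap
    · rfl
    funext ω
    ext w
    simp only [accepted, Function.comp, Finset.mem_sdiff, Finset.mem_image, Finset.mem_range,
      Finset.mem_univ, true_and, Subtype.exists]
    grind
  have hmap := (ProbabilityTheory.indepFun_iff_map_prod_eq_prod_map_map
    hX.aemeasurable hY.aemeasurable).1 hind2
  have hYmap : μ.map (fun ω => ω t) = p.toMeasure := Measure.infinitePi_map_eval _ t
  have hmeas : Measurable fun x : Finset (List T) × Draw T => f x.1 x.2 :=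
    measurable_of_countable _
  calc ∫⁻ ω, f (accepted F ω t) (ω t) ∂μ
      = ∫⁻ x, f x.1 x.2 ∂(μ.map fun ω => (accepted F ω t, ω t)) := by
        rw [lintegral_map hmeas (hX.prodMk hY)]
    _ = ∫⁻ X, ∫⁻ d, f X d ∂p.toMeasure ∂(μ.map fun ω => accepted F ω t) := by
        rw [hmap, hYmap, lintegral_prod _ hmeas.aemeasurable]
    _ = _ := by
        rw [lintegral_map (measurable_of_countable _) hX]
        simp only [PMF.lintegral_toMeasure]

/-- Expected number of further draws of a collector who owns `c` of the `M` coupons and wants `k`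
of them, when a draw yields each coupon with probability `1 / N`. -/
noncomputable def couponBound (N M k c : ℕ) : ℝ≥0∞ :=
  ∑ i ∈ Finset.Ico c k, (N : ℝ≥0∞) / ((M - i : ℕ) : ℝ≥0∞)

theorem couponBound_of_lt {N M k c : ℕ} (h : c < k) :
    couponBound N M k c = (N : ℝ≥0∞) / ((M - c : ℕ) : ℝ≥0∞) + couponBound N M k (c + 1) := by
  rw [couponBound, Finset.sum_eq_sum_Ico_succ_bot h]
  rfl

theorem couponBound_of_le {N M k c : ℕ} (h : k ≤ c) : couponBound N M k c = 0 := by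
  simp [couponBound, Finset.Ico_eq_empty_of_le h]

/-- A uniform generator has exact mass one on its target, so that it draws nothing else. -/
theorem IsUniformGenerator.word_mem {p : PMF (Draw T)} {S : Set (List T)}
    (hp : IsUniformGenerator p S) (hS : S.Finite) (hne : S.Nonempty) {d : Draw T} (hd : p d ≠ 0) :
    d.word ∈ S := by
  classical
  by_contra hmem
  have hmass : ∑ w ∈ hS.toFinset, (p.map Draw.word) w = 1 := by
    rw [Finset.sum_congr rfl fun w hw => hp w (hS.mem_toFinset.1 hw), Finset.sum_const,
      nsmul_eq_mul, ← Set.ncard_eq_toFinset_card S hS]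
    exact ENNReal.mul_inv_cancel (by simpa using (Set.ncard_pos hS).2 hne |>.ne') (by simp)
  have hle : ∑ w ∈ insert d.word hS.toFinset, (p.map Draw.word) w ≤ 1 :=
    (ENNReal.sum_le_tsum _).trans_eq (p.map Draw.word).tsum_coe
  rw [Finset.sum_insert (by simpa using hmem), hmass] at hle
  have h0 : (p.map Draw.word) d.word = 0 := by
    by_contra h
    rw [add_comm] at hle
    exact absurd hle (not_le.2 (ENNReal.lt_add_right (by simp) h))
  have hsupp : d.word ∈ (p.map Draw.word).support :=
    (PMF.mem_support_map_iff _ _ _).2 ⟨d, (PMF.mem_support_iff _ _).2 hd, rfl⟩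
  exact (PMF.mem_support_iff _ _).1 hsupp h0

open Classical in
/-- A uniform generator hits a subset of its target with probability the ratio of the sizes. -/
theorem IsUniformGenerator.expect_mem {p : PMF (Draw T)} {S : Set (List T)}
    (hp : IsUniformGenerator p S) (U : Finset (List T)) (hU : (U : Set (List T)) ⊆ S) :
    (p.expect fun d => if d.word ∈ U then 1 else 0) = (U.card : ℝ≥0∞) / (S.ncard : ℝ≥0∞) := by
  have h := PMF.expect_map p Draw.word fun w => if w ∈ U then (1 : ℝ≥0∞) else 0
  rw [← h, PMF.expect, tsum_eq_sum (s := U) (by intro b hb; simp [hb])]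
  rw [Finset.sum_congr rfl fun w hw => by rw [hp w (hU hw), if_pos hw, mul_one]]
  rw [Finset.sum_const, nsmul_eq_mul, div_eq_mul_inv]

open Classical in
/-- One draw decreases the expected number of missing draws by at least one. -/
theorem IsUniformGenerator.expect_couponBound {p : PMF (Draw T)} {S : Set (List T)}
    (hp : IsUniformGenerator p S) (hS : S.Finite) (F : Finset (List T))
    {k : ℕ} (hk : k + F.card ≤ S.ncard) (X : Finset (List T)) :
    (p.expect fun d => couponBound S.ncard (S.ncard - F.card) k (X ∪ ({d.word} \ F)).card) +
      (if X.card < k then 1 else 0) ≤ couponBound S.ncard (S.ncard - F.card) k X.card := by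
  set N := S.ncard with hN
  set M := N - F.card with hM
  split_ifs with hX
  · set q : ℝ≥0∞ := (N : ℝ≥0∞) / ((M - X.card : ℕ) : ℝ≥0∞) with hq
    set U : Finset (List T) := (hS.toFinset \ F) \ X with hU
    have hUS : (U : Set (List T)) ⊆ S := by
      intro w hw
      simp only [hU, Finset.coe_sdiff, Set.Finite.coe_toFinset, Set.mem_sdiff] at hw
      exact hw.1.1
    have hUcard : M - X.card ≤ U.card := by
      have h1 := Finset.le_card_sdiff F hS.toFinset
      have h2 : (hS.toFinset \ F).card - X.card ≤ U.card :=
        Finset.le_card_sdiff X (hS.toFinset \ F)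
      rw [← Set.ncard_eq_toFinset_card S hS] at h1
      omega
    have hpos : 0 < M - X.card := by omega
    -- a draw in `U` yields a new word, and such a draw is made with probability at least `1 / q`
    have hstep : ∀ d : Draw T, couponBound N M k (X ∪ ({d.word} \ F)).card ≤
        couponBound N M k (X.card + 1) + q * (if d.word ∈ U then 0 else 1) := by
      intro d
      split_ifs with hd
      · simp only [hU, Finset.mem_sdiff, Set.Finite.mem_toFinset] at hd
        have : (X ∪ ({d.word} \ F)).card = X.card + 1 := by
          rw [Finset.sdiff_eq_self_of_disjoint (by simpa using hd.1.2), Finset.union_comm,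
            ← Finset.insert_eq, Finset.card_insert_of_notMem hd.2]
        simp [this]
      · rw [mul_one, add_comm, hq, ← couponBound_of_lt hX]
        exact Finset.sum_le_sum_of_subset
          (Finset.Ico_subset_Ico_left (Finset.card_le_card Finset.subset_union_left))
    have hone : (1 : ℝ≥0∞) ≤ q * (p.expect fun d => if d.word ∈ U then 1 else 0) := by
      have hN0 : (N : ℝ≥0∞) ≠ 0 := by
        have : N ≠ 0 := by omega
        exact_mod_cast this
      rw [hp.expect_mem U hUS, ← hN]
      calc (1 : ℝ≥0∞) = q * (((M - X.card : ℕ) : ℝ≥0∞) / (N : ℝ≥0∞)) := by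
            rw [hq, div_eq_mul_inv, div_eq_mul_inv, mul_assoc, ← mul_assoc _ _ (N : ℝ≥0∞)⁻¹,
              ENNReal.inv_mul_cancel (Nat.cast_ne_zero.2 hpos.ne') (by simp), one_mul,
              ENNReal.mul_inv_cancel hN0 (by simp)]
        _ ≤ _ := by gcongr
    calc (p.expect fun d => couponBound N M k (X ∪ ({d.word} \ F)).card) + 1
        ≤ (p.expect fun d => couponBound N M k (X.card + 1) +
            q * (if d.word ∈ U then 0 else 1)) +
            q * (p.expect fun d => if d.word ∈ U then 1 else 0) := by
          gcongr
          exact p.expect_mono fun d _ => hstep d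
      _ = couponBound N M k (X.card + 1) + q * (p.expect fun d =>
            (if d.word ∈ U then 0 else 1) + (if d.word ∈ U then 1 else 0)) := by
          rw [PMF.expect_add, PMF.expect_const, PMF.expect_mul_left, PMF.expect_add]
          ring
      _ = couponBound N M k (X.card + 1) + q := by
          congr 1
          rw [show (fun d : Draw T => ((if d.word ∈ U then 0 else 1) +
            (if d.word ∈ U then 1 else 0) : ℝ≥0∞)) = fun _ => 1 by
              funext d; split_ifs <;> simp, PMF.expect_const, mul_one]
      _ = couponBound N M k X.card := by rw [couponBound_of_lt hX, add_comm]
  · rw [couponBound_of_le (not_lt.1 hX), add_zero]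
    refine le_of_eq_of_le (p.expect_congr (h := fun _ => 0) fun d _ => ?_) (by
      rw [PMF.expect_const])
    exact couponBound_of_le ((not_lt.1 hX).trans (Finset.card_le_card Finset.subset_union_left))

/-- The expected number of draws of the rejection approach. -/
theorem IsUniformGenerator.tsum_lintegral_le [Countable T] {p : PMF (Draw T)} {S : Set (List T)}
    (hp : IsUniformGenerator p S) (hS : S.Finite) (F : Finset (List T))
    {k : ℕ} (hk : k + F.card ≤ S.ncard) :
    ∑' t, ∫⁻ ω, (if (accepted F ω t).card < k then 1 else 0)
        ∂(Measure.infinitePi fun _ : ℕ => p.toMeasure) ≤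
      couponBound S.ncard (S.ncard - F.card) k 0 := by
  classical
  set μ := Measure.infinitePi fun _ : ℕ => p.toMeasure with hμ
  set h := couponBound S.ncard (S.ncard - F.card) k with hh
  have key : ∀ n : ℕ, ∑ t ∈ Finset.range n,
      ∫⁻ ω, (if (accepted F ω t).card < k then 1 else 0) ∂μ +
        ∫⁻ ω, h (accepted F ω n).card ∂μ ≤ h 0 := by
    intro n
    induction n with
    | zero => simp [accepted_zero]
    | succ n ih =>
      refine le_trans ?_ ih
      rw [Finset.sum_range_succ, add_assoc]
      gcongr
      simp only [accepted_succ]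
      rw [lintegral_apply_accepted p F n fun X d => h (X ∪ ({d.word} \ F)).card, ← hμ,
        ← lintegral_add_left (measurable_apply_accepted F n fun X _ =>
          (if X.card < k then (1 : ℝ≥0∞) else 0))]
      refine lintegral_mono fun ω => ?_
      rw [add_comm]
      exact hp.expect_couponBound hS F hk _
  exact ENNReal.tsum_le_of_sum_range_le fun n => le_self_add.trans (key n)

/-- Wald's identity for the rejection approach: the decision to make a draw depends on the
preceding draws only, so every draw that is made costs a mean draw. -/
theorem rejectionCost_eq [Countable T] (p : PMF (Draw T)) (F : Finset (List T)) (k : ℕ) :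
    rejectionCost p F k =
      (∑' t, ∫⁻ ω, (if (accepted F ω t).card < k then 1 else 0)
        ∂(Measure.infinitePi fun _ : ℕ => p.toMeasure)) *
        p.expect fun d => ((d.steps + d.word.length : ℕ) : ℝ≥0∞) := by
  simp only [rejectionCost, rejectionTime]
  rw [lintegral_tsum fun t => (measurable_apply_accepted F t fun X d =>
    if X.card < k then ((d.steps + d.word.length : ℕ) : ℝ≥0∞) else 0).aemeasurable,
    ← ENNReal.tsum_mul_right]
  refine tsum_congr fun t => ?_
  rw [lintegral_apply_accepted p F t fun X d =>
    if X.card < k then ((d.steps + d.word.length : ℕ) : ℝ≥0∞) else 0,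
    ← lintegral_mul_const _ (measurable_apply_accepted F t fun X _ =>
          (if X.card < k then (1 : ℝ≥0∞) else 0))]
  refine lintegral_congr fun ω => ?_
  split_ifs
  · rw [one_mul]
  · rw [PMF.expect_const, zero_mul]

/-- The coupon collector's estimate, by comparison with a harmonic sum: `M / (M - i)` is at most
`k / (k - i)` for `i < k ≤ M`. -/
theorem couponBound_zero_le {N M k : ℕ} (hk : 2 ≤ k) (hkM : k ≤ M) :
    couponBound N M k 0 ≤
      ENNReal.ofReal (3 * ((N : ℝ) / (M : ℝ)) * ((k : ℝ) * Real.log (k : ℝ))) := by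
  have hM0 : (0 : ℝ) < M := by exact_mod_cast (by omega : 0 < M)
  have hterm : ∀ i ∈ Finset.range k, (N : ℝ≥0∞) / ((M - i : ℕ) : ℝ≥0∞) ≤
      ENNReal.ofReal ((N : ℝ) / M * k * (((k - 1 - i : ℕ) : ℝ) + 1)⁻¹) := by
    intro i hi
    rw [Finset.mem_range] at hi
    have hMi : (0 : ℝ) < ((M - i : ℕ) : ℝ) := by exact_mod_cast (by omega : 0 < M - i)
    rw [← ENNReal.ofReal_natCast N, ← ENNReal.ofReal_natCast (M - i),
      ← ENNReal.ofReal_div_of_pos hMi]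
    refine ENNReal.ofReal_le_ofReal ?_
    have h1 : ((k - 1 - i : ℕ) : ℝ) + 1 = k - i := by
      rw [Nat.cast_sub (by omega), Nat.cast_sub (by omega)]
      push_cast
      ring
    have h2 : ((M - i : ℕ) : ℝ) = M - i := by rw [Nat.cast_sub (by omega)]
    have hki : (0 : ℝ) < k - i := by
      rw [sub_pos]
      exact_mod_cast hi
    rw [h2] at hMi
    have hkM' : (k : ℝ) ≤ M := by exact_mod_cast hkM
    rw [h1, h2, ← div_eq_mul_inv, div_mul_eq_mul_div, div_div, div_le_div_iff₀ hMi (by positivity),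
      mul_assoc]
    refine mul_le_mul_of_nonneg_left ?_ (by positivity)
    nlinarith [Nat.cast_nonneg (α := ℝ) i]
  have hlog : (1 : ℝ) + Real.log k ≤ 3 * Real.log k := by
    have h1 : Real.log 2 ≤ Real.log k := Real.log_le_log (by norm_num) (by exact_mod_cast hk)
    have h2 := Real.log_two_gt_d9
    linarith
  have hharm : ∑ i ∈ Finset.range k, (((k - 1 - i : ℕ) : ℝ) + 1)⁻¹ ≤ 1 + Real.log k := by
    rw [Finset.sum_range_reflect (fun i : ℕ => ((i : ℝ) + 1)⁻¹) k]
    have h := harmonic_le_one_add_log k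
    simpa [harmonic] using h
  calc couponBound N M k 0
      = ∑ i ∈ Finset.range k, (N : ℝ≥0∞) / ((M - i : ℕ) : ℝ≥0∞) := by
        rw [couponBound, Finset.range_eq_Ico]
    _ ≤ ∑ i ∈ Finset.range k,
          ENNReal.ofReal ((N : ℝ) / M * k * (((k - 1 - i : ℕ) : ℝ) + 1)⁻¹) :=
        Finset.sum_le_sum hterm
    _ = ENNReal.ofReal (∑ i ∈ Finset.range k,
          (N : ℝ) / M * k * (((k - 1 - i : ℕ) : ℝ) + 1)⁻¹) :=
        (ENNReal.ofReal_sum_of_nonneg fun i _ => by positivity).symm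
    _ ≤ _ := by
        refine ENNReal.ofReal_le_ofReal ?_
        rw [← Finset.mul_sum]
        calc (N : ℝ) / M * k * ∑ i ∈ Finset.range k, (((k - 1 - i : ℕ) : ℝ) + 1)⁻¹
            ≤ (N : ℝ) / M * k * (3 * Real.log k) := by
              gcongr
              exact hharm.trans hlog
          _ = _ := by ring

theorem sizeSlice_finite [Finite T] (L : Language T) (n : ℕ) : (sizeSlice L n).Finite :=
  (List.finite_length_eq T n).subset fun _ hw => hw.2

/-- The complexity of the rejection approach for any language and any family of uniform
generators. -/
theorem exists_rejectionCost_le [Finite T] (L : Language T) (G : ℕ → PMF (Draw T))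
    (hG : ∀ n : ℕ, 0 < n → IsUniformGenerator (G n) (sizeSlice L n)) (ε : ℝ) (hε : 0 < ε)
    (hmean : ∃ c : ℝ, ∀ n : ℕ, 0 < n → (sizeSlice L n).Nonempty →
      meanSteps (G n) ≤ ENNReal.ofReal (c * (n : ℝ) ^ (1 + ε))) :
    ∃ K : ℝ, ∀ n : ℕ, 0 < n → ∀ F : Finset (List T), (F : Set (List T)) ⊆ sizeSlice L n →
      ∀ k : ℕ, 2 ≤ k → k + F.card ≤ (sizeSlice L n).ncard →
      rejectionCost (G n) F k ≤ ENNReal.ofReal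
        (K * (((sizeSlice L n).ncard : ℝ) /
            (((sizeSlice L n).ncard : ℝ) - (F.card : ℝ))) *
          (n : ℝ) ^ (1 + ε) * ((k : ℝ) * Real.log (k : ℝ))) := by
  obtain ⟨c, hc⟩ := hmean
  refine ⟨3 * (|c| + 1), fun n hn F _ k hk hkF => ?_⟩
  have hfin := sizeSlice_finite L n
  have hne : (sizeSlice L n).Nonempty := Set.nonempty_of_ncard_ne_zero (by omega)
  set N := (sizeSlice L n).ncard with hN
  have hn1 : (1 : ℝ) ≤ n := by exact_mod_cast hn
  have hpow : (n : ℝ) ≤ (n : ℝ) ^ (1 + ε) := by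
    calc (n : ℝ) = (n : ℝ) ^ (1 : ℝ) := (Real.rpow_one _).symm
      _ ≤ _ := Real.rpow_le_rpow_of_exponent_le hn1 (by linarith)
  have hdraw : ((G n).expect fun d => ((d.steps + d.word.length : ℕ) : ℝ≥0∞)) ≤
      ENNReal.ofReal ((|c| + 1) * (n : ℝ) ^ (1 + ε)) := by
    calc ((G n).expect fun d => ((d.steps + d.word.length : ℕ) : ℝ≥0∞))
        = (G n).expect fun d => (d.steps : ℝ≥0∞) + (n : ℝ≥0∞) := by
          refine (G n).expect_congr fun d hd => ?_
          rw [((hG n hn).word_mem hfin hne hd).2]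
          push_cast
          rfl
      _ = meanSteps (G n) + n := by
          rw [PMF.expect_add, PMF.expect_const, meanSteps_eq_expect]
      _ ≤ ENNReal.ofReal (|c| * (n : ℝ) ^ (1 + ε)) + ENNReal.ofReal ((n : ℝ) ^ (1 + ε)) := by
          refine add_le_add ((hc n hn hne).trans (ENNReal.ofReal_le_ofReal ?_)) ?_
          · gcongr
            exact le_abs_self c
          · rw [← ENNReal.ofReal_natCast n]
            exact ENNReal.ofReal_le_ofReal hpow
      _ = _ := by
          rw [← ENNReal.ofReal_add (by positivity) (by positivity)]
          congr 1
          ring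
  have hcast : ((N - F.card : ℕ) : ℝ) = (N : ℝ) - F.card := by rw [Nat.cast_sub (by omega)]
  have hlog : 0 ≤ Real.log k := Real.log_nonneg (by exact_mod_cast (by omega : 1 ≤ k))
  rw [rejectionCost_eq]
  calc _ ≤ ENNReal.ofReal (3 * ((N : ℝ) / ((N - F.card : ℕ) : ℝ)) * ((k : ℝ) * Real.log k)) *
        ENNReal.ofReal ((|c| + 1) * (n : ℝ) ^ (1 + ε)) :=
        mul_le_mul' (((hG n hn).tsum_lintegral_le hfin F hkF).trans
          (couponBound_zero_le hk (by omega))) hdraw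
    _ = _ := by
        rw [← ENNReal.ofReal_mul (by positivity), hcast]
        congr 1
        ring

end Rejection

/-! ### Parse trees and derivations -/

namespace ParseTree

variable {T : Type*} {N : Type}

/-- The number of nodes on a longest branch. -/
def height : ParseTree T N → ℕ
  | leaf _ _ => 1
  | unit _ s => s.height + 1
  | node _ l r => max l.height r.height + 1

/-- The nonterminals met from the root down to the first node that is not a unit production: all
of them have the whole word as their yield. -/
def unitChain : ParseTree T N → List N
  | leaf A _ => [A]
  | unit A s => A :: s.unitChain
  | node A _ _ => [A]

theorem length_yield_pos : ∀ s : ParseTree T N, 0 < s.yield.length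
  | leaf _ _ => by simp [yield]
  | unit _ s => s.length_yield_pos
  | node _ l _ => by
      have := l.length_yield_pos
      simp only [yield, List.length_append]
      omega

theorem length_unitChain_pos (s : ParseTree T N) : 0 < s.unitChain.length := by
  cases s <;> simp [unitChain]

end ParseTree

namespace CNFGrammar

variable {T : Type*} (g : CNFGrammar T)

/-- The word `w` is the yield of a parse tree whose root is `A`. -/
def HasTree (A : g.NT) (w : List T) : Prop :=
  ∃ s : ParseTree T g.NT, g.IsParseTree s ∧ s.root = A ∧ s.yield = w

/-- A word has at most one parse tree whose root is `A`. -/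
def UnambiguousAt (A : g.NT) : Prop :=
  ∀ s s' : ParseTree T g.NT, g.IsParseTree s → g.IsParseTree s' →
    s.root = A → s'.root = A → s.yield = s'.yield → s = s'

variable {g}

theorem HasTree.length_pos {A : g.NT} {w : List T} (h : g.HasTree A w) : 0 < w.length := by
  obtain ⟨s, -, -, rfl⟩ := h
  exact s.length_yield_pos

theorem HasTree.union_left {A B C : g.NT} (hA : g.rule A = .union B C) {w : List T}
    (h : g.HasTree B w) : g.HasTree A w := by
  obtain ⟨s, hs, rfl, rfl⟩ := h
  exact ⟨.unit A s, ⟨⟨_, _, hA, Or.inl rfl⟩, hs⟩, rfl, rfl⟩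

theorem HasTree.union_right {A B C : g.NT} (hA : g.rule A = .union B C) {w : List T}
    (h : g.HasTree C w) : g.HasTree A w := by
  obtain ⟨s, hs, rfl, rfl⟩ := h
  exact ⟨.unit A s, ⟨⟨_, _, hA, Or.inr rfl⟩, hs⟩, rfl, rfl⟩

theorem HasTree.prod {A B C : g.NT} (hA : g.rule A = .prod B C) {u v : List T}
    (hu : g.HasTree B u) (hv : g.HasTree C v) : g.HasTree A (u ++ v) := by
  obtain ⟨s, hs, rfl, rfl⟩ := hu
  obtain ⟨s', hs', rfl, rfl⟩ := hv
  exact ⟨.node A s s', ⟨hA, hs, hs'⟩, rfl, rfl⟩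

theorem hasTree_term_iff {A : g.NT} {t : T} (hA : g.rule A = .term t) {w : List T} :
    g.HasTree A w ↔ w = [t] := by
  constructor
  · rintro ⟨s | s | s, hs, rfl, rfl⟩ <;> simp_all [IsParseTree, ParseTree.root, ParseTree.yield]
  · rintro rfl
    exact ⟨.leaf A t, hA, rfl, rfl⟩

theorem hasTree_union_iff {A B C : g.NT} (hA : g.rule A = .union B C) {w : List T} :
    g.HasTree A w ↔ g.HasTree B w ∨ g.HasTree C w := by
  refine ⟨?_, fun h => h.elim (.union_left hA) (.union_right hA)⟩
  rintro ⟨s | ⟨A', s⟩ | s, hs, rfl, rfl⟩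
  · simp_all [IsParseTree, ParseTree.root]
  · obtain ⟨⟨B', C', hr, h⟩, hs⟩ := hs
    obtain ⟨rfl, rfl⟩ := CNFRule.union.inj (hr.symm.trans hA)
    exact h.imp (fun h => ⟨s, hs, h, rfl⟩) fun h => ⟨s, hs, h, rfl⟩
  · simp_all [IsParseTree, ParseTree.root]

theorem hasTree_prod_iff {A B C : g.NT} (hA : g.rule A = .prod B C) {w : List T} :
    g.HasTree A w ↔ ∃ u v, w = u ++ v ∧ g.HasTree B u ∧ g.HasTree C v := by
  refine ⟨?_, by rintro ⟨u, v, rfl, hu, hv⟩; exact hu.prod hA hv⟩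
  rintro ⟨s | s | ⟨A', l, r⟩, hs, rfl, rfl⟩
  · simp_all [IsParseTree, ParseTree.root]
  · obtain ⟨⟨B', C', hr, -⟩, -⟩ := hs
    simp_all [ParseTree.root]
  · obtain ⟨hr, hl, hr'⟩ := hs
    obtain ⟨h1, h2⟩ := CNFRule.prod.inj (hr.symm.trans hA)
    exact ⟨l.yield, r.yield, rfl, ⟨l, hl, h1, rfl⟩, ⟨r, hr', h2, rfl⟩⟩

theorem mem_toCFG_rules {r : ContextFreeRule T g.NT} :
    r ∈ g.toCFG.rules ↔ (∃ A, ∃ o ∈ (g.rule A).outputs, r = ⟨A, o⟩) ∨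
      (g.nullable ∧ r = ⟨g.start, []⟩) := by
  classical
  refine (Finset.mem_union (α := ContextFreeRule T g.NT)).trans (or_congr ?_ ?_)
  · simp only [Finset.mem_biUnion, Finset.mem_univ, true_and, List.mem_toFinset, List.mem_map]
    exact exists_congr fun A => exists_congr fun o => and_congr_right fun _ => eq_comm
  · split_ifs with h <;> simp [h]

theorem derives_of_mem_outputs {A : g.NT} {o : List (Symbol T g.NT)}
    (ho : o ∈ (g.rule A).outputs) : g.toCFG.Derives [.nonterminal A] o :=
  ContextFreeGrammar.Produces.single
    ⟨⟨A, o⟩, mem_toCFG_rules.2 (Or.inl ⟨A, o, ho, rfl⟩), ContextFreeRule.Rewrites.input_output⟩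

theorem IsParseTree.derives : ∀ s : ParseTree T g.NT, g.IsParseTree s →
    g.toCFG.Derives [.nonterminal s.root] (s.yield.map .terminal)
  | .leaf A t, h => by
      have h : g.rule A = .term t := h
      refine derives_of_mem_outputs (A := A) ?_
      rw [h]
      exact List.mem_singleton.2 rfl
  | .unit A s, ⟨⟨B, C, hr, h⟩, hs⟩ => by
      refine ContextFreeGrammar.Derives.trans (derives_of_mem_outputs (A := A) ?_)
        (IsParseTree.derives s hs)
      rw [hr]
      rcases h with rfl | rfl
      · exact List.mem_cons_self
      · exact List.mem_cons_of_mem _ List.mem_cons_self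
  | .node A l r, ⟨hr, hl, hr'⟩ => by
      refine ContextFreeGrammar.Derives.trans (derives_of_mem_outputs (A := A)
        (o := [.nonterminal l.root, .nonterminal r.root]) ?_) ?_
      · rw [hr]
        exact List.mem_singleton.2 rfl
      · have h1 := (IsParseTree.derives l hl).append_right [.nonterminal r.root]
        have h2 := (IsParseTree.derives r hr').append_left (l.yield.map .terminal)
        rw [ParseTree.yield, List.map_append]
        exact h1.trans h2

variable (g) in
/-- The words that a symbol stands for, in terms of parse trees: the start symbol of a nullable
grammar stands for the empty word as well. -/
def Expands : Symbol T g.NT → List T → Prop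
  | .terminal t, w => w = [t]
  | .nonterminal A, w => g.HasTree A w ∨ (g.nullable ∧ A = g.start ∧ w = [])

variable (g) in
/-- The words that a sentential form stands for. -/
def ExpandsList : List (Symbol T g.NT) → List T → Prop
  | [], w => w = []
  | a :: u, w => ∃ x y, w = x ++ y ∧ g.Expands a x ∧ ExpandsList u y

theorem expandsList_append {u v : List (Symbol T g.NT)} {w : List T} :
    g.ExpandsList (u ++ v) w ↔ ∃ x y, w = x ++ y ∧ g.ExpandsList u x ∧ g.ExpandsList v y := by
  induction u generalizing w with
  | nil => simp [ExpandsList]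
  | cons a u ih =>
    simp only [List.cons_append, ExpandsList, ih]
    constructor
    · rintro ⟨x, _, rfl, hx, y, z, rfl, hy, hz⟩
      exact ⟨x ++ y, z, by simp, ⟨x, y, rfl, hx, hy⟩, hz⟩
    · rintro ⟨_, z, rfl, ⟨x, y, rfl, hx, hy⟩, hz⟩
      exact ⟨x, y ++ z, by simp, hx, y, z, rfl, hy, hz⟩

theorem expandsList_singleton {a : Symbol T g.NT} {w : List T} :
    g.ExpandsList [a] w ↔ g.Expands a w := by
  simp [ExpandsList]

theorem expandsList_map_terminal (w : List T) : g.ExpandsList (w.map .terminal) w := by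
  induction w with
  | nil => simp [ExpandsList]
  | cons t w ih => exact ⟨[t], w, rfl, rfl, ih⟩

/-- Inside a right-hand side the start symbol of a nullable grammar does not occur, so that every
nonterminal there stands for the yield of a parse tree. -/
theorem Expands.hasTree {A B : g.NT} {o : List (Symbol T g.NT)} (ho : o ∈ (g.rule A).outputs)
    (hB : .nonterminal B ∈ o) {w : List T} (h : g.Expands (.nonterminal B) w) : g.HasTree B w := by
  rcases h with h | ⟨hn, rfl, -⟩
  · exact h
  · exact absurd hB (g.start_not_mem hn A o ho)

theorem expands_of_rule {r : ContextFreeRule T g.NT} (hr : r ∈ g.toCFG.rules) {w : List T}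
    (h : g.ExpandsList r.output w) : g.Expands (.nonterminal r.input) w := by
  rcases mem_toCFG_rules.1 hr with ⟨A, o, ho, rfl⟩ | ⟨hn, rfl⟩
  · refine Or.inl ?_
    change g.ExpandsList o w at h
    change g.HasTree A w
    rcases hA : g.rule A with ⟨B, C⟩ | ⟨B, C⟩ | t
    · have ho' := ho
      rw [hA, CNFRule.outputs, List.mem_singleton] at ho'
      subst ho'
      obtain ⟨x, y, rfl, hx, hy⟩ := h
      rw [expandsList_singleton] at hy
      exact (hx.hasTree ho (by simp)).prod hA (hy.hasTree ho (by simp))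
    · have ho' := ho
      rw [hA, CNFRule.outputs] at ho'
      simp only [List.mem_cons, List.not_mem_nil, or_false] at ho'
      rcases ho' with rfl | rfl
      · exact ((expandsList_singleton.1 h).hasTree ho (by simp)).union_left hA
      · exact ((expandsList_singleton.1 h).hasTree ho (by simp)).union_right hA
    · rw [hA, CNFRule.outputs, List.mem_singleton] at ho
      subst ho
      exact (hasTree_term_iff hA).2 (expandsList_singleton.1 h)
  · exact Or.inr ⟨hn, rfl, h⟩

theorem ExpandsList.of_derives {u : List (Symbol T g.NT)} {w : List T}
    (h : g.toCFG.Derives u (w.map .terminal)) : g.ExpandsList u w := by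
  induction h using Relation.ReflTransGen.head_induction_on with
  | refl => exact expandsList_map_terminal w
  | head h _ ih =>
    obtain ⟨r, hr, hrw⟩ := h
    obtain ⟨p, q, rfl, rfl⟩ := hrw.exists_parts
    obtain ⟨x, y, rfl, hx, hy⟩ := expandsList_append.1 ih
    obtain ⟨x₁, x₂, rfl, hx₁, hx₂⟩ := expandsList_append.1 hx
    exact expandsList_append.2 ⟨_, _, rfl, expandsList_append.2
      ⟨_, _, rfl, hx₁, expandsList_singleton.2 (expands_of_rule hr hx₂)⟩, hy⟩

theorem mem_languageOf_iff {A : g.NT} {w : List T} (hw : 0 < w.length) :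
    w ∈ g.languageOf A ↔ g.HasTree A w := by
  constructor
  · intro h
    rcases expandsList_singleton.1 (ExpandsList.of_derives (g := g)
      (u := [.nonterminal A]) h) with h | ⟨-, -, rfl⟩
    · exact h
    · simp at hw
  · rintro ⟨s, hs, rfl, rfl⟩
    exact IsParseTree.derives s hs

theorem mem_sizeSlice_iff {A : g.NT} {m : ℕ} (hm : 0 < m) {w : List T} :
    w ∈ sizeSlice (g.languageOf A) m ↔ g.HasTree A w ∧ w.length = m := by
  constructor
  · rintro ⟨h, rfl⟩
    exact ⟨(mem_languageOf_iff hm).1 h, rfl⟩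
  · rintro ⟨h, rfl⟩
    exact ⟨(mem_languageOf_iff hm).2 h, rfl⟩

/-! ### Consequences of unambiguity -/

theorem UnambiguousAt.union_left {A B C : g.NT} (h : g.UnambiguousAt A)
    (hA : g.rule A = .union B C) : g.UnambiguousAt B := by
  intro s s' hs hs' hr hr' hy
  have := h (.unit A s) (.unit A s') ⟨⟨B, C, hA, Or.inl hr⟩, hs⟩ ⟨⟨B, C, hA, Or.inl hr'⟩, hs'⟩
    rfl rfl hy
  simpa using this

theorem UnambiguousAt.union_right {A B C : g.NT} (h : g.UnambiguousAt A)
    (hA : g.rule A = .union B C) : g.UnambiguousAt C := by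
  intro s s' hs hs' hr hr' hy
  have := h (.unit A s) (.unit A s') ⟨⟨B, C, hA, Or.inr hr⟩, hs⟩ ⟨⟨B, C, hA, Or.inr hr'⟩, hs'⟩
    rfl rfl hy
  simpa using this

theorem UnambiguousAt.prod_left {A B C : g.NT} (h : g.UnambiguousAt A)
    (hA : g.rule A = .prod B C) {v : List T} (hv : g.HasTree C v) : g.UnambiguousAt B := by
  obtain ⟨r, hr, rfl, rfl⟩ := hv
  rintro s s' hs hs' rfl hr' hy
  have := h (.node A s r) (.node A s' r) ⟨hA, hs, hr⟩ ⟨hr' ▸ hA, hs', hr⟩ rfl rfl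
    (by simp [ParseTree.yield, hy])
  simpa using this

theorem UnambiguousAt.prod_right {A B C : g.NT} (h : g.UnambiguousAt A)
    (hA : g.rule A = .prod B C) {u : List T} (hu : g.HasTree B u) : g.UnambiguousAt C := by
  obtain ⟨l, hl, rfl, rfl⟩ := hu
  rintro s s' hs hs' rfl hr' hy
  have := h (.node A l s) (.node A l s') ⟨hA, hl, hs⟩ ⟨hr' ▸ hA, hl, hs'⟩ rfl rfl
    (by simp [ParseTree.yield, hy])
  simpa using this

/-- The two alternatives of an unambiguous union have no word in common. -/
theorem UnambiguousAt.not_hasTree_of_ne {A B C : g.NT} (h : g.UnambiguousAt A)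
    (hA : g.rule A = .union B C) (hBC : B ≠ C) {w : List T} (hB : g.HasTree B w) :
    ¬ g.HasTree C w := by
  rintro ⟨s', hs', hr', rfl⟩
  obtain ⟨s, hs, hr, hy⟩ := hB
  have := h (.unit A s) (.unit A s') ⟨⟨B, C, hA, Or.inl hr⟩, hs⟩ ⟨⟨B, C, hA, Or.inr hr'⟩, hs'⟩
    rfl rfl hy
  simp only [ParseTree.unit.injEq, true_and] at this
  exact hBC (by rw [← hr, ← hr', this])

/-- A word of an unambiguous product has a single factorization. -/
theorem UnambiguousAt.append_left_inj {A B C : g.NT} (h : g.UnambiguousAt A)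
    (hA : g.rule A = .prod B C) {u v u' v' : List T} (hu : g.HasTree B u) (hv : g.HasTree C v)
    (hu' : g.HasTree B u') (hv' : g.HasTree C v') (huv : u ++ v = u' ++ v') : u = u' := by
  obtain ⟨s, hs, hr, rfl⟩ := hu
  obtain ⟨t, ht, hq, rfl⟩ := hv
  obtain ⟨s', hs', hr', rfl⟩ := hu'
  obtain ⟨t', ht', hq', rfl⟩ := hv'
  have := h (.node A s t) (.node A s' t') ⟨by rw [hr, hq, hA], hs, ht⟩
    ⟨by rw [hr', hq', hA], hs', ht'⟩ rfl rfl huv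
  simp only [ParseTree.node.injEq, true_and] at this
  rw [this.1]

theorem IsParseTree.exists_of_mem_unitChain {B : g.NT} : ∀ s : ParseTree T g.NT,
    g.IsParseTree s → B ∈ s.unitChain →
      ∃ s', g.IsParseTree s' ∧ s'.root = B ∧ s'.yield = s.yield ∧ s'.height ≤ s.height
  | .leaf A t, h, hB => ⟨.leaf A t, h, (List.mem_singleton.1 hB).symm, rfl, le_rfl⟩
  | .unit A s, h, hB => by
      rcases List.mem_cons.1 hB with rfl | hB
      · exact ⟨.unit B s, h, rfl, rfl, le_rfl⟩
      · obtain ⟨s', h1, h2, h3, h4⟩ := IsParseTree.exists_of_mem_unitChain s h.2 hB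
        exact ⟨s', h1, h2, h3, h4.trans (Nat.le_succ _)⟩
  | .node A l r, h, hB => ⟨.node A l r, h, (List.mem_singleton.1 hB).symm, rfl, le_rfl⟩

theorem UnambiguousAt.of_unit {A : g.NT} {s : ParseTree T g.NT} (h : g.UnambiguousAt A)
    (hs : g.IsParseTree (.unit A s)) : g.UnambiguousAt s.root := by
  obtain ⟨⟨B, C, hA, hr⟩, -⟩ := hs
  rcases hr with hr | hr
  · exact hr ▸ h.union_left hA
  · exact hr ▸ h.union_right hA

/-- A nonterminal that came back along unit productions would give two trees for the same word,
one of them a proper subtree of the other. -/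
theorem UnambiguousAt.nodup_unitChain : ∀ s : ParseTree T g.NT, g.IsParseTree s →
    g.UnambiguousAt s.root → s.unitChain.Nodup
  | .leaf A t, _, _ => by simp [ParseTree.unitChain]
  | .unit A s, h, hu => by
      refine List.nodup_cons.2 ⟨fun hA => ?_,
        UnambiguousAt.nodup_unitChain s h.2 (UnambiguousAt.of_unit hu h)⟩
      obtain ⟨s', h1, h2, h3, h4⟩ := IsParseTree.exists_of_mem_unitChain s h.2 hA
      have := hu s' (.unit A s) h1 h h2 rfl h3
      rw [this, ParseTree.height] at h4
      omega
  | .node A l r, _, _ => by simp [ParseTree.unitChain]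

theorem UnambiguousAt.length_unitChain_le {s : ParseTree T g.NT} (h : g.UnambiguousAt s.root)
    (hs : g.IsParseTree s) : s.unitChain.length ≤ Fintype.card g.NT :=
  (UnambiguousAt.nodup_unitChain s hs h).length_le_card

theorem UnambiguousAt.height_add_card_le : ∀ s : ParseTree T g.NT, g.IsParseTree s →
    g.UnambiguousAt s.root →
      s.height + Fintype.card g.NT ≤ s.unitChain.length + Fintype.card g.NT * s.yield.length
  | .leaf A t, _, _ => by simp [ParseTree.height, ParseTree.unitChain, ParseTree.yield]
  | .unit A s, h, hu => by
      have := UnambiguousAt.height_add_card_le s h.2 (UnambiguousAt.of_unit hu h)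
      simp only [ParseTree.height, ParseTree.unitChain, ParseTree.yield, List.length_cons]
      omega
  | .node A l r, h, hu => by
      have hul : g.UnambiguousAt l.root := hu.prod_left h.1 ⟨r, h.2.2, rfl, rfl⟩
      have hur : g.UnambiguousAt r.root := hu.prod_right h.1 ⟨l, h.2.1, rfl, rfl⟩
      have h1 := UnambiguousAt.height_add_card_le l h.2.1 hul
      have h2 := UnambiguousAt.height_add_card_le r h.2.2 hur
      have h3 := hul.length_unitChain_le h.2.1
      have h4 := hur.length_unitChain_le h.2.2
      have h5 := Nat.mul_le_mul_left (Fintype.card g.NT) l.length_yield_pos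
      have h6 := Nat.mul_le_mul_left (Fintype.card g.NT) r.length_yield_pos
      simp only [ParseTree.height, ParseTree.unitChain, ParseTree.yield, List.length_append,
        List.length_singleton, mul_add]
      omega

theorem UnambiguousAt.height_le {s : ParseTree T g.NT} (h : g.UnambiguousAt s.root)
    (hs : g.IsParseTree s) : s.height ≤ Fintype.card g.NT * s.yield.length := by
  have h1 := UnambiguousAt.height_add_card_le s hs h
  have h2 := h.length_unitChain_le hs
  omega

/-! ### Numbers of words -/

theorem count_pos_iff [Finite T] {A : g.NT} {m : ℕ} (hm : 0 < m) :
    0 < g.count A m ↔ ∃ w, g.HasTree A w ∧ w.length = m := by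
  rw [count, Set.ncard_pos (sizeSlice_finite _ _)]
  exact exists_congr fun w => mem_sizeSlice_iff hm

theorem count_le_of_union_left [Finite T] {A B C : g.NT} (hA : g.rule A = .union B C) {m : ℕ}
    (hm : 0 < m) : g.count B m ≤ g.count A m := by
  refine Set.ncard_le_ncard (fun w hw => ?_) (sizeSlice_finite _ _)
  rw [mem_sizeSlice_iff hm] at hw ⊢
  exact ⟨hw.1.union_left hA, hw.2⟩

theorem UnambiguousAt.count_add_count_le [Finite T] {A B C : g.NT} (h : g.UnambiguousAt A)
    (hA : g.rule A = .union B C) (hBC : B ≠ C) {m : ℕ} (hm : 0 < m) :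
    g.count B m + g.count C m ≤ g.count A m := by
  have hdisj : Disjoint (sizeSlice (g.languageOf B) m) (sizeSlice (g.languageOf C) m) := by
    refine Set.disjoint_left.2 fun w hB hC => ?_
    rw [mem_sizeSlice_iff hm] at hB hC
    exact h.not_hasTree_of_ne hA hBC hB.1 hC.1
  rw [count, count, count,
    ← Set.ncard_union_eq hdisj (sizeSlice_finite _ _) (sizeSlice_finite _ _)]
  refine Set.ncard_le_ncard (fun w hw => ?_) (sizeSlice_finite _ _)
  rw [Set.mem_union, mem_sizeSlice_iff hm, mem_sizeSlice_iff hm] at hw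
  rw [mem_sizeSlice_iff hm, hasTree_union_iff hA]
  tauto

theorem UnambiguousAt.sum_count_mul_count_le [Finite T] {A B C : g.NT} (h : g.UnambiguousAt A)
    (hA : g.rule A = .prod B C) (m : ℕ) :
    ∑ i ∈ Finset.Ico 1 m, g.count B i * g.count C (m - i) ≤ g.count A m := by
  classical
  let S : Finset (Σ _ : ℕ, List T × List T) := (Finset.Ico 1 m).sigma fun i =>
    (sizeSlice_finite (g.languageOf B) i).toFinset ×ˢ
      (sizeSlice_finite (g.languageOf C) (m - i)).toFinset
  have hS : ∀ x ∈ S, 1 ≤ x.1 ∧ x.1 < m ∧ (g.HasTree B x.2.1 ∧ x.2.1.length = x.1) ∧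
      g.HasTree C x.2.2 ∧ x.2.2.length = m - x.1 := by
    intro x hx
    simp only [S, Finset.mem_sigma, Finset.mem_Ico, Finset.mem_product,
      Set.Finite.mem_toFinset] at hx
    obtain ⟨⟨h1, h2⟩, h3, h4⟩ := hx
    exact ⟨h1, h2, (mem_sizeSlice_iff h1).1 h3, (mem_sizeSlice_iff (by omega)).1 h4⟩
  have hcard : S.card = ∑ i ∈ Finset.Ico 1 m, g.count B i * g.count C (m - i) := by
    simp only [S, Finset.card_sigma, Finset.card_product, count,
      Set.ncard_eq_toFinset_card _ (sizeSlice_finite _ _)]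
  rw [← hcard, count, Set.ncard_eq_toFinset_card _ (sizeSlice_finite _ _)]
  refine Finset.card_le_card_of_injOn (fun x => x.2.1 ++ x.2.2) (fun x hx => ?_) ?_
  · obtain ⟨h1, h2, ⟨h3, h4⟩, h5, h6⟩ := hS x hx
    simp only [Set.Finite.coe_toFinset]
    rw [mem_sizeSlice_iff (by omega)]
    exact ⟨h3.prod hA h5, by rw [List.length_append]; omega⟩
  · rintro ⟨i, u, v⟩ hx ⟨i', u', v'⟩ hx' huv
    obtain ⟨-, -, ⟨h3, h4⟩, h5, -⟩ := hS _ hx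
    obtain ⟨-, -, ⟨h3', h4'⟩, h5', -⟩ := hS _ hx'
    have hu : u = u' := h.append_left_inj hA h3 h5 h3' h5' huv
    subst hu
    have hv : v = v' := List.append_cancel_left huv
    subst hv
    simp only at h4 h4'
    rw [← h4, ← h4']

theorem exists_count_pos_of_prod [Finite T] {A B C : g.NT} (hA : g.rule A = .prod B C) {m : ℕ}
    (hm : 0 < m) (h : 0 < g.count A m) :
    ∃ i ∈ Finset.Ico 1 m, 0 < g.count B i * g.count C (m - i) := by
  obtain ⟨w, hw, rfl⟩ := (count_pos_iff hm).1 h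
  obtain ⟨u, v, rfl, hu, hv⟩ := (hasTree_prod_iff hA).1 hw
  have hu0 := hu.length_pos
  have hv0 := hv.length_pos
  rw [List.length_append]
  refine ⟨u.length, Finset.mem_Ico.2 ⟨hu0, by omega⟩, Nat.mul_pos ?_ ?_⟩
  · exact (count_pos_iff hu0).2 ⟨u, hu, rfl⟩
  · rw [Nat.add_sub_cancel_left]
    exact (count_pos_iff hv0).2 ⟨v, hv, rfl⟩

end CNFGrammar

/-! ### The random test -/

theorem agreements_expect (f : ℕ → ℝ≥0∞) :
    agreements.expect f = ∑' j, (2⁻¹ : ℝ≥0∞) ^ (j + 1) * f j := rfl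

theorem ENNReal.inv_two_pow_succ_mul_two (n : ℕ) :
    (2⁻¹ : ℝ≥0∞) ^ (n + 1) * 2 = 2⁻¹ ^ n := by
  rw [pow_succ, mul_assoc, ENNReal.inv_mul_cancel (by simp) (by simp), mul_one]

theorem sum_range_agreements_readCost (s n : ℕ) :
    ∑ j ∈ Finset.range n, (2⁻¹ : ℝ≥0∞) ^ (j + 1) * (((j + 1) * (s + (j + 1)) : ℕ) : ℝ≥0∞) +
      2⁻¹ ^ n * (((n + 2) * s + n ^ 2 + 4 * n + 6 : ℕ) : ℝ≥0∞) = ((2 * s + 6 : ℕ) : ℝ≥0∞) := by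
  induction n with
  | zero => simp
  | succ n ih =>
    rw [← ih, Finset.sum_range_succ, add_assoc, ← mul_add,
      ← ENNReal.inv_two_pow_succ_mul_two n, mul_assoc _ (2 : ℝ≥0∞)]
    congr 2
    norm_cast
    ring

/-- A test reads at most two digits on average, so that its expected cost is of the order of the bit length
of the table. -/
theorem expect_coinTest_readCost_le {m L : ℕ} (hm : Nat.size m ≤ L) (hL : 1 ≤ L) (a b : ℕ) :
    ((coinTest a b).expect fun x => (readCost m x.2 : ℝ≥0∞)) ≤ ((8 * L : ℕ) : ℝ≥0∞) := by
  rw [coinTest]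
  split_ifs
  · rw [PMF.expect_pure]
    norm_cast
    simp only [readCost]
    omega
  · rw [PMF.expect_map, agreements_expect]
    refine le_trans (b := ((2 * Nat.size m + 6 : ℕ) : ℝ≥0∞))
      (ENNReal.tsum_le_of_sum_range_le fun n => ?_) (by norm_cast; omega)
    rw [← sum_range_agreements_readCost (Nat.size m) n]
    exact le_self_add

theorem sum_range_digits {a b : ℕ} (hab : a < b) (n : ℕ) :
    ∑ j ∈ Finset.range n, (2⁻¹ : ℝ≥0∞) ^ (j + 1) * ((2 ^ (j + 1) * a / b % 2 : ℕ) : ℝ≥0∞) =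
      2⁻¹ ^ n * ((2 ^ n * a / b : ℕ) : ℝ≥0∞) := by
  induction n with
  | zero => simp [Nat.div_eq_of_lt hab]
  | succ n ih =>
    rw [Finset.sum_range_succ, ih, ← ENNReal.inv_two_pow_succ_mul_two n, mul_assoc, ← mul_add]
    congr 1
    norm_cast
    have h : 2 ^ (n + 1) * a / b / 2 = 2 ^ n * a / b := by
      rw [Nat.div_div_eq_div_mul, pow_succ, mul_right_comm, Nat.mul_div_mul_right _ _ (by norm_num)]
    have := Nat.div_add_mod (2 ^ (n + 1) * a / b) 2
    omega

/-- A number of `[0, 1)` is the sum of the series of its binary digits. -/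
theorem tsum_digits {a b : ℕ} (hab : a < b) :
    ∑' j, (2⁻¹ : ℝ≥0∞) ^ (j + 1) * ((2 ^ (j + 1) * a / b % 2 : ℕ) : ℝ≥0∞) =
      (a : ℝ≥0∞) / (b : ℝ≥0∞) := by
  have hb0 : (b : ℝ≥0∞) ≠ 0 := by exact_mod_cast (by omega : b ≠ 0)
  have hpow : ∀ n : ℕ, (2⁻¹ : ℝ≥0∞) ^ n * 2 ^ n = 1 := fun n => by
    rw [← mul_pow, ENNReal.inv_mul_cancel (by simp) (by simp), one_pow]
  refine le_antisymm (ENNReal.tsum_le_of_sum_range_le fun n => ?_) ?_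
  · rw [sum_range_digits hab, ENNReal.le_div_iff_mul_le (Or.inl hb0) (Or.inl (by simp))]
    calc (2⁻¹ : ℝ≥0∞) ^ n * ((2 ^ n * a / b : ℕ) : ℝ≥0∞) * b
        = (2⁻¹ : ℝ≥0∞) ^ n * ((2 ^ n * a / b * b : ℕ) : ℝ≥0∞) := by push_cast; ring
      _ ≤ (2⁻¹ : ℝ≥0∞) ^ n * ((2 ^ n * a : ℕ) : ℝ≥0∞) := by
          exact mul_le_mul' le_rfl (by exact_mod_cast Nat.div_mul_le_self _ _)
      _ = a := by push_cast; rw [← mul_assoc, hpow, one_mul]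
  · set s := ∑' j, (2⁻¹ : ℝ≥0∞) ^ (j + 1) * ((2 ^ (j + 1) * a / b % 2 : ℕ) : ℝ≥0∞) with hs
    have hle : ∀ n : ℕ, (a : ℝ≥0∞) / b ≤ s + 2⁻¹ ^ n := by
      intro n
      have h1 : (2⁻¹ : ℝ≥0∞) ^ n * ((2 ^ n * a / b : ℕ) : ℝ≥0∞) ≤ s := by
        rw [← sum_range_digits hab]
        exact ENNReal.sum_le_tsum _
      refine le_trans ?_ (add_le_add_left h1 _)
      refine ENNReal.div_le_of_le_mul ?_
      calc (a : ℝ≥0∞) = (2⁻¹ : ℝ≥0∞) ^ n * ((2 ^ n * a : ℕ) : ℝ≥0∞) := by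
            push_cast
            rw [← mul_assoc, hpow, one_mul]
        _ ≤ (2⁻¹ : ℝ≥0∞) ^ n * (((2 ^ n * a / b + 1) * b : ℕ) : ℝ≥0∞) := by
            refine mul_le_mul' le_rfl (Nat.cast_le.2 ?_)
            have h2 := Nat.div_add_mod (2 ^ n * a) b
            have h3 := Nat.mod_lt (2 ^ n * a) (show 0 < b by omega)
            rw [add_mul, one_mul, mul_comm _ b]
            omega
        _ = _ := by push_cast; ring
    have hlim : Filter.Tendsto (fun n : ℕ => s + (2⁻¹ : ℝ≥0∞) ^ n) Filter.atTop
        (nhds (s + 0)) :=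
      (ENNReal.tendsto_pow_atTop_nhds_zero_of_lt_one (by simp)).const_add s
    rw [add_zero] at hlim
    exact ge_of_tendsto' hlim hle

/-- A test succeeds with the required probability. -/
theorem expect_coinTest_ite {a b : ℕ} (hb : 0 < b) (hab : a ≤ b) (u v : ℝ≥0∞) :
    ((coinTest a b).expect fun x => if x.1 then u else v) =
      (a : ℝ≥0∞) / b * u + ((b - a : ℕ) : ℝ≥0∞) / b * v := by
  have hb0 : (b : ℝ≥0∞) ≠ 0 := by exact_mod_cast hb.ne'
  rw [coinTest]
  split_ifs with h
  · obtain rfl : a = b := le_antisymm hab h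
    rw [PMF.expect_pure]
    simp [ENNReal.div_self hb0]
  · rw [not_le] at h
    rw [PMF.expect_map]
    have hp : (agreements.expect fun j => ((2 ^ (j + 1) * a / b % 2 : ℕ) : ℝ≥0∞)) =
        (a : ℝ≥0∞) / b := tsum_digits h
    have hpq : (a : ℝ≥0∞) / b +
        (agreements.expect fun j => ((1 - 2 ^ (j + 1) * a / b % 2 : ℕ) : ℝ≥0∞)) = 1 := by
      rw [← hp, ← PMF.expect_add, ← agreements.expect_const 1]
      refine PMF.expect_congr _ fun j _ => ?_
      norm_cast
      have := Nat.mod_lt (2 ^ (j + 1) * a / b) (by norm_num : 2 > 0)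
      omega
    have hq : (agreements.expect fun j => ((1 - 2 ^ (j + 1) * a / b % 2 : ℕ) : ℝ≥0∞)) =
        ((b - a : ℕ) : ℝ≥0∞) / b := by
      have hab' : (a : ℝ≥0∞) / b + ((b - a : ℕ) : ℝ≥0∞) / b = 1 := by
        rw [← ENNReal.add_div]
        norm_cast
        rw [Nat.add_sub_cancel' hab]
        exact ENNReal.div_self hb0 (by simp)
      exact (ENNReal.add_right_inj (ENNReal.div_ne_top (by simp) hb0)).1 (hpq.trans hab'.symm)
    rw [← hp, ← hq, mul_comm _ u, mul_comm _ v, ← PMF.expect_mul_left, ← PMF.expect_mul_left,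
      ← PMF.expect_add]
    refine PMF.expect_congr _ fun j _ => ?_
    rcases Nat.mod_two_eq_zero_or_one (2 ^ (j + 1) * a / b) with h0 | h1
    · simp [h0]
    · simp [h1]

/-! ### The random choice -/

theorem expect_pick_cons (m : ℕ) (wt : ℕ → ℕ) (i : ℕ) (is : List ℕ) (f : ℕ × ℕ → ℝ≥0∞) :
    (pick m wt (i :: is)).expect f =
      (coinTest (wt i) (wt i + (is.map wt).sum)).expect fun x =>
        if x.1 then f (i, readCost m x.2)
        else (pick m wt is).expect fun y => f (y.1, readCost m x.2 + y.2) := by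
  rw [pick, PMF.expect_bind, List.map_cons, List.sum_cons]
  refine PMF.expect_congr _ fun x _ => ?_
  split_ifs
  · rw [PMF.expect_pure]
  · rw [PMF.expect_map]

theorem le_expect_pick (m : ℕ) (wt : ℕ → ℕ) (f : ℕ → ℝ≥0∞) (l : List ℕ) {i : ℕ} (hi : i ∈ l)
    (hwt : 0 < wt i) :
    (wt i : ℝ≥0∞) / ((l.map wt).sum : ℕ) * f i ≤ (pick m wt l).expect fun y => f y.1 := by
  induction l with
  | nil => simp at hi
  | cons i' is ih =>
    have hsum : 0 < wt i' + (is.map wt).sum := by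
      rcases List.mem_cons.1 hi with rfl | hi
      · omega
      · have := List.single_le_sum (fun _ _ => Nat.zero_le _) _ (List.mem_map_of_mem (f := wt) hi)
        omega
    rw [expect_pick_cons]
    change _ ≤ (coinTest (wt i') (wt i' + (is.map wt).sum)).expect fun x =>
      if x.1 then f i' else (pick m wt is).expect fun y => f y.1
    rw [expect_coinTest_ite hsum (Nat.le_add_right _ _), List.map_cons,
      List.sum_cons, Nat.add_sub_cancel_left]
    rcases List.mem_cons.1 hi with rfl | hi
    · exact le_self_add
    · have h0 : 0 < (is.map wt).sum := by
        have := List.single_le_sum (fun _ _ => Nat.zero_le _) _ (List.mem_map_of_mem (f := wt) hi)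
        omega
      have h0' : (((is.map wt).sum : ℕ) : ℝ≥0∞) ≠ 0 := by exact_mod_cast h0.ne'
      refine le_trans ?_ le_add_self
      calc (wt i : ℝ≥0∞) / ((wt i' + (is.map wt).sum : ℕ) : ℝ≥0∞) * f i
          = ((is.map wt).sum : ℕ) / ((wt i' + (is.map wt).sum : ℕ) : ℝ≥0∞) *
              ((wt i : ℝ≥0∞) / ((is.map wt).sum : ℕ) * f i) := by
            simp only [div_eq_mul_inv]
            rw [show ∀ s t w x y : ℝ≥0∞, s * t * (w * x * y) = (s * x) * (w * t * y) by
              intros; ring, ENNReal.mul_inv_cancel h0' (ENNReal.natCast_ne_top _), one_mul]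
        _ ≤ _ := by
            gcongr
            exact ih hi

/-- If the element number `j` costs at most `D - κ j` afterwards, and a test costs at most `κ` on
average, then a choice and what follows cost at most `κ + D` on average. -/
theorem expect_pick_le {m : ℕ} {κ : ℝ≥0∞} (hκ : κ ≠ ∞)
    (hcoin : ∀ a b, ((coinTest a b).expect fun x => (readCost m x.2 : ℝ≥0∞)) ≤ κ)
    (wt : ℕ → ℕ) (D : ℝ≥0∞) (l : List ℕ) (f : ℕ → ℝ≥0∞) (hl : 0 < (l.map wt).sum)
    (H : ∀ (j : ℕ) (hj : j < l.length), 0 < wt l[j] → κ * j + f l[j] ≤ D) :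
    ((pick m wt l).expect fun y => (y.2 : ℝ≥0∞) + f y.1) ≤ κ + D := by
  induction l generalizing f with
  | nil => simp at hl
  | cons i is ih =>
    rw [List.map_cons, List.sum_cons] at hl
    have hhead : 0 < wt i → f i ≤ D := fun h => le_add_self.trans (H 0 (by simp) h)
    have htail : 0 < (is.map wt).sum →
        ((pick m wt is).expect fun y => (y.2 : ℝ≥0∞) + f y.1) ≤ D := fun h => by
      -- in the tail every element comes one test later: `κ` is added to `f`, and cancelled below
      have h1 := ih (fun i => f i + κ) h fun j hj hw => by
        have := H (j + 1) (by simpa using hj) (by simpa using hw)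
        rw [List.getElem_cons_succ] at this
        refine le_of_eq_of_le ?_ this
        push_cast
        ring
      simp only [← add_assoc] at h1
      rw [PMF.expect_add _ _ fun _ => κ, PMF.expect_const, add_comm] at h1
      exact (ENNReal.add_le_add_iff_left hκ).1 h1
    rw [expect_pick_cons]
    calc _ = (coinTest (wt i) (wt i + (is.map wt).sum)).expect fun x =>
          (readCost m x.2 : ℝ≥0∞) + if x.1 then f i else
            (pick m wt is).expect fun y => (y.2 : ℝ≥0∞) + f y.1 := by
          refine PMF.expect_congr _ fun x _ => ?_
          split_ifs
          · rfl
          · push_cast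
            simp only [add_assoc]
            rw [PMF.expect_add _ fun _ => _, PMF.expect_const]
      _ ≤ κ + ((wt i : ℝ≥0∞) / (wt i + (is.map wt).sum : ℕ) * D +
            ((is.map wt).sum : ℝ≥0∞) / (wt i + (is.map wt).sum : ℕ) * D) := by
          rw [PMF.expect_add, expect_coinTest_ite hl (Nat.le_add_right _ _),
            Nat.add_sub_cancel_left]
          refine add_le_add (hcoin _ _) (add_le_add ?_ ?_)
          · rcases Nat.eq_zero_or_pos (wt i) with h | h
            · simp [h]
            · gcongr
              exact hhead h
          · rcases Nat.eq_zero_or_pos (is.map wt).sum with h | h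
            · simp [h]
            · gcongr
              exact htail h
      _ = κ + D := by
          rw [← add_mul, ← ENNReal.add_div, ← Nat.cast_add, ENNReal.div_self
            (by exact_mod_cast hl.ne') (ENNReal.natCast_ne_top _), one_mul]

/-! ### The boustrophedon order -/

theorem boustrophedon_getElem {m j : ℕ} (hj : j < (boustrophedon m).length) :
    j < m - 1 ∧ (boustrophedon m)[j] = if j % 2 = 0 then j / 2 + 1 else m - 1 - j / 2 := by
  simp only [boustrophedon, List.length_map, List.length_range] at hj
  exact ⟨hj, by simp [boustrophedon]⟩

theorem mem_boustrophedon {m i : ℕ} : i ∈ boustrophedon m ↔ i ∈ Finset.Ico 1 m := by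
  rw [Finset.mem_Ico]
  simp only [boustrophedon, List.mem_map, List.mem_range]
  constructor
  · rintro ⟨j, hj, rfl⟩
    split_ifs <;> omega
  · rintro ⟨h1, h2⟩
    by_cases h : 2 * i ≤ m
    · exact ⟨2 * (i - 1), by omega, by rw [if_pos (by omega)]; omega⟩
    · exact ⟨2 * (m - 1 - i) + 1, by omega, by rw [if_neg (by omega)]; omega⟩

theorem nodup_boustrophedon (m : ℕ) : (boustrophedon m).Nodup := by
  refine List.Nodup.map_on (fun j hj j' hj' h => ?_) List.nodup_range
  rw [List.mem_range] at hj hj'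
  split_ifs at h <;> omega

theorem sum_map_boustrophedon (m : ℕ) (wt : ℕ → ℕ) :
    ((boustrophedon m).map wt).sum = ∑ i ∈ Finset.Ico 1 m, wt i := by
  rw [← List.sum_toFinset _ (nodup_boustrophedon m)]
  congr 1
  ext i
  rw [List.mem_toFinset, mem_boustrophedon]

theorem Nat.size_succ_le_of_two_mul_le {i m : ℕ} (hi : 0 < i) (h : 2 * i ≤ m) :
    Nat.size i + 1 ≤ Nat.size m := by
  obtain ⟨s, hs⟩ := Nat.exists_eq_succ_of_ne_zero (Nat.size_pos.2 hi).ne'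
  have h1 : 2 ^ s ≤ i := Nat.lt_size.1 (by omega)
  rw [hs]
  exact Nat.lt_size.2 (by rw [Nat.pow_succ]; omega)

/-- The superadditivity of `m ↦ m * size m`, with a gain of the smaller part: this gain pays for
the search of the splitting position in the boustrophedon order. -/
theorem Nat.mul_size_add_mul_size_le {i j : ℕ} (hi : 0 < i) (hij : i ≤ j) :
    i * Nat.size i + j * Nat.size j + i ≤ (i + j) * Nat.size (i + j) := by
  have h1 := Nat.size_succ_le_of_two_mul_le hi (show 2 * i ≤ i + j by omega)
  have h2 : Nat.size j ≤ Nat.size (i + j) := Nat.size_le_size (by omega)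
  calc i * Nat.size i + j * Nat.size j + i = i * (Nat.size i + 1) + j * Nat.size j := by ring
    _ ≤ i * Nat.size (i + j) + j * Nat.size (i + j) := by gcongr
    _ = _ := by ring

theorem boustrophedon_gain {m j : ℕ} (hj : j < (boustrophedon m).length) {i : ℕ}
    (hi : (boustrophedon m)[j] = i) :
    2 * (i * Nat.size i) + 2 * ((m - i) * Nat.size (m - i)) + j ≤ 2 * (m * Nat.size m) := by
  obtain ⟨h1, h2⟩ := boustrophedon_getElem hj
  rw [hi] at h2
  have hi1 : 0 < i ∧ i < m ∧ j ≤ 2 * i ∧ j ≤ 2 * (m - i) := by split_ifs at h2 <;> omega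
  rcases le_total i (m - i) with h | h
  · have := Nat.mul_size_add_mul_size_le hi1.1 h
    rw [Nat.add_sub_cancel' hi1.2.1.le] at this
    omega
  · have := Nat.mul_size_add_mul_size_le (by omega) h
    rw [Nat.sub_add_cancel hi1.2.1.le] at this
    omega

/-! ### The recursive generator -/

namespace CNFGrammar

variable {T : Type*} {g : CNFGrammar T}

theorem expect_generateFrom_term {A : g.NT} {t : T} (hA : g.rule A = .term t) (d m : ℕ)
    (f : Draw T → ℝ≥0∞) : (g.generateFrom (d + 1) A m).expect f = f ⟨[t], Nat.size m⟩ := by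
  simp only [generateFrom, hA, PMF.expect_pure]

theorem expect_generateFrom_union {A B C : g.NT} (hA : g.rule A = .union B C) (d m : ℕ)
    (f : Draw T → ℝ≥0∞) : (g.generateFrom (d + 1) A m).expect f =
      (coinTest (g.count B m) (g.count B m + g.count C m)).expect fun x =>
        (g.generateFrom d (if x.1 then B else C) m).expect fun y =>
          f ⟨y.word, Nat.size m + readCost m x.2 + y.steps⟩ := by
  simp only [generateFrom, hA, PMF.expect_bind, PMF.expect_map]

theorem expect_generateFrom_prod {A B C : g.NT} (hA : g.rule A = .prod B C) (d m : ℕ)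
    (f : Draw T → ℝ≥0∞) : (g.generateFrom (d + 1) A m).expect f =
      (pick m (fun i => g.count B i * g.count C (m - i)) (boustrophedon m)).expect fun x =>
        (g.generateFrom d B x.1).expect fun y => (g.generateFrom d C (m - x.1)).expect fun z =>
          f ⟨y.word ++ z.word, Nat.size m + x.2 + y.steps + z.steps⟩ := by
  simp only [generateFrom, hA, PMF.expect_bind, PMF.expect_map]

theorem inv_le_div_mul_of_inv_le {a b c : ℕ} {x : ℝ≥0∞} (ha : 0 < a) (hbc : b ≤ c)
    (hx : (a : ℝ≥0∞)⁻¹ ≤ x) : (c : ℝ≥0∞)⁻¹ ≤ (a : ℝ≥0∞) / b * x := by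
  calc (c : ℝ≥0∞)⁻¹ ≤ (b : ℝ≥0∞)⁻¹ := ENNReal.inv_le_inv.2 (by exact_mod_cast hbc)
    _ = (a : ℝ≥0∞) / b * (a : ℝ≥0∞)⁻¹ := by
        rw [div_eq_mul_inv, mul_right_comm, ENNReal.mul_inv_cancel
          (by exact_mod_cast ha.ne') (by simp), one_mul]
    _ ≤ _ := by gcongr

open Classical in
/-- Every word is drawn at least as often as it should be, if the depth allowed to the recursion
bounds the height of the parse trees. -/
theorem UnambiguousAt.inv_count_le_expect [Finite T] (d : ℕ) {A : g.NT} {w : List T}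
    (h : g.UnambiguousAt A) (hw : g.HasTree A w)
    (hd : ∀ s, g.IsParseTree s → s.root = A → s.yield.length = w.length → s.height ≤ d) :
    (g.count A w.length : ℝ≥0∞)⁻¹ ≤
      (g.generateFrom d A w.length).expect fun x => if x.word = w then 1 else 0 := by
  induction d generalizing A w with
  | zero =>
    obtain ⟨s, hs, hr, hy⟩ := hw
    have := hd s hs hr (by rw [hy])
    cases s <;> simp [ParseTree.height] at this
  | succ d ih =>
    have hm := hw.length_pos
    have hA0 : 0 < g.count A w.length := (count_pos_iff hm).2 ⟨w, hw, rfl⟩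
    rcases hA : g.rule A with ⟨B, C⟩ | ⟨B, C⟩ | t
    · rw [expect_generateFrom_prod hA]
      obtain ⟨u, v, rfl, hu, hv⟩ := (hasTree_prod_iff hA).1 hw
      have hu0 := hu.length_pos
      have hv0 := hv.length_pos
      have hlen : (u ++ v).length - u.length = v.length := by simp
      have hB := ih (h.prod_left hA hv) hu fun s hs hr hy => by
        obtain ⟨s', hs', rfl, rfl⟩ := hv
        have := hd (.node A s s') ⟨by rw [hr, hA], hs, hs'⟩ rfl (by simp [ParseTree.yield, hy])
        simp only [ParseTree.height] at this
        omega
      have hC := ih (h.prod_right hA hu) hv fun s hs hr hy => by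
        obtain ⟨s', hs', rfl, rfl⟩ := hu
        have := hd (.node A s' s) ⟨by rw [hr, hA], hs', hs⟩ rfl (by simp [ParseTree.yield, hy])
        simp only [ParseTree.height] at this
        omega
      have hB0 : 0 < g.count B u.length := (count_pos_iff hu0).2 ⟨u, hu, rfl⟩
      have hC0 : 0 < g.count C v.length := (count_pos_iff hv0).2 ⟨v, hv, rfl⟩
      refine le_trans ?_ (le_expect_pick (u ++ v).length
        (fun i => g.count B i * g.count C ((u ++ v).length - i))
        (fun i => (g.generateFrom d B i).expect fun y =>
          (g.generateFrom d C ((u ++ v).length - i)).expect fun z =>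
            if y.word ++ z.word = u ++ v then 1 else 0) _
        (i := u.length) (mem_boustrophedon.2 ?_) ?_)
      · refine inv_le_div_mul_of_inv_le ?_ ?_ ?_
        · rw [hlen]
          positivity
        · rw [sum_map_boustrophedon]
          exact h.sum_count_mul_count_le hA _
        · rw [hlen]
          calc ((g.count B u.length * g.count C v.length : ℕ) : ℝ≥0∞)⁻¹
              = (g.count B u.length : ℝ≥0∞)⁻¹ * (g.count C v.length : ℝ≥0∞)⁻¹ := by
                rw [Nat.cast_mul, ENNReal.mul_inv (Or.inr (by simp)) (Or.inl (by simp))]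
            _ ≤ _ := mul_le_mul' hB hC
            _ = (g.generateFrom d B u.length).expect fun y =>
                  (g.generateFrom d C v.length).expect fun z =>
                    (if y.word = u then 1 else 0) * if z.word = v then 1 else 0 := by
                simp only [PMF.expect_mul_left]
                rw [mul_comm, ← PMF.expect_mul_left]
                simp only [mul_comm]
            _ ≤ _ := by
                refine PMF.expect_mono _ fun y _ => PMF.expect_mono _ fun z _ => ?_
                split_ifs <;> simp_all
      · rw [Finset.mem_Ico, List.length_append]
        omega
      · simp only [hlen]
        positivity
    · rw [expect_generateFrom_union hA]
      have hunit : ∀ D : g.NT, (D = B ∨ D = C) → ∀ s, g.IsParseTree s → s.root = D →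
          s.yield.length = w.length → s.height ≤ d := by
        rintro D hD s hs rfl hy
        have := hd (.unit A s) ⟨⟨B, C, hA, hD⟩, hs⟩ rfl hy
        simpa [ParseTree.height] using this
      have hite : ((coinTest (g.count B w.length)
          (g.count B w.length + g.count C w.length)).expect fun x =>
            (g.generateFrom d (if x.1 then B else C) w.length).expect fun y =>
              if y.word = w then (1 : ℝ≥0∞) else 0) =
          (coinTest (g.count B w.length)
          (g.count B w.length + g.count C w.length)).expect fun x => if x.1 then
            (g.generateFrom d B w.length).expect fun y => if y.word = w then 1 else 0 else
            (g.generateFrom d C w.length).expect fun y => if y.word = w then 1 else 0 := by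
        refine PMF.expect_congr _ fun x _ => ?_
        split_ifs <;> rfl
      refine le_of_le_of_eq ?_ hite.symm
      by_cases hBC : B = C
      -- with equal alternatives the numbers of words do not add up, but the test is immaterial
      · subst hBC
        simp only [ite_self, PMF.expect_const]
        have hB : g.HasTree B w := by simpa using (hasTree_union_iff hA).1 hw
        refine le_trans ?_ (ih (h.union_left hA) hB (hunit B (Or.inl rfl)))
        exact ENNReal.inv_le_inv.2 (by exact_mod_cast count_le_of_union_left hA hm)
      · have hle := h.count_add_count_le hA hBC hm
        rcases (hasTree_union_iff hA).1 hw with hB | hC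
        · have hB0 : 0 < g.count B w.length := (count_pos_iff hm).2 ⟨w, hB, rfl⟩
          rw [expect_coinTest_ite (by omega) (by omega)]
          exact (inv_le_div_mul_of_inv_le hB0 hle
            (ih (h.union_left hA) hB (hunit B (Or.inl rfl)))).trans le_self_add
        · have hC0 : 0 < g.count C w.length := (count_pos_iff hm).2 ⟨w, hC, rfl⟩
          rw [expect_coinTest_ite (by omega) (by omega), Nat.add_sub_cancel_left]
          exact (inv_le_div_mul_of_inv_le hC0 hle
            (ih (h.union_right hA) hC (hunit C (Or.inr rfl)))).trans le_add_self
    · rw [expect_generateFrom_term hA]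
      obtain rfl := (hasTree_term_iff hA).1 hw
      simp only [if_true]
      exact ENNReal.inv_le_one.2 (by exact_mod_cast hA0)

theorem Unambiguous.isUniformGenerator [Finite T] (h : g.Unambiguous) {n : ℕ} (hn : 0 < n) :
    IsUniformGenerator (g.generator n) (sizeSlice g.language n) := by
  classical
  have hu : g.UnambiguousAt g.start := h
  have hfin := sizeSlice_finite g.language n
  have hcount : g.count g.start n = (sizeSlice g.language n).ncard := rfl
  have hle : ∀ w ∈ sizeSlice g.language n, ((sizeSlice g.language n).ncard : ℝ≥0∞)⁻¹ ≤
      ((g.generator n).map Draw.word) w := by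
    intro w hw
    obtain ⟨ht, rfl⟩ := (mem_sizeSlice_iff (g := g) (A := g.start) hn).1 hw
    have h1 : ((g.generator w.length).map Draw.word) w =
        (g.generator w.length).expect fun x => if x.word = w then 1 else 0 := by
      rw [← PMF.expect_map _ Draw.word fun w' => if w' = w then (1 : ℝ≥0∞) else 0, PMF.expect,
        tsum_eq_single w fun b hb => by simp [hb]]
      simp
    rw [h1, ← hcount]
    refine hu.inv_count_le_expect _ ht fun s hs hr hy => ?_
    have hheight := UnambiguousAt.height_le (hr ▸ hu) hs
    rw [hy] at hheight
    nlinarith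
  intro w hw
  refine le_antisymm ?_ (hle w hw)
  -- the lower bounds add up to one already, so that none of them is strict
  by_contra hlt
  rw [not_le] at hlt
  have hN0 : (sizeSlice g.language n).ncard ≠ 0 := ((Set.ncard_pos hfin).2 ⟨w, hw⟩).ne'
  have hsum : ∑ w ∈ hfin.toFinset, ((sizeSlice g.language n).ncard : ℝ≥0∞)⁻¹ = 1 := by
    rw [Finset.sum_const, nsmul_eq_mul, ← Set.ncard_eq_toFinset_card _ hfin]
    exact ENNReal.mul_inv_cancel (by exact_mod_cast hN0) (by simp)
  have hmem : w ∈ hfin.toFinset := hfin.mem_toFinset.2 hw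
  have hone : ∑ w ∈ hfin.toFinset, ((g.generator n).map Draw.word) w ≤ 1 :=
    (ENNReal.sum_le_tsum _).trans_eq (PMF.tsum_coe _)
  rw [← hsum, ← Finset.add_sum_erase _ _ hmem, ← Finset.add_sum_erase _ _ hmem] at hone
  refine absurd hone (not_le.2 (ENNReal.add_lt_add_of_lt_of_le ?_ hlt
    (Finset.sum_le_sum fun v hv => hle v (hfin.mem_toFinset.1 (Finset.mem_of_mem_erase hv)))))
  exact (ENNReal.sum_lt_top.2 fun v _ =>
    ENNReal.inv_lt_top.2 (by exact_mod_cast Nat.pos_of_ne_zero hN0)).ne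

/-- The expected time of the recursive generator, for any depth of the recursion; `r` bounds the
length of the unit chains of the parse trees.  Every visit of a nonterminal is charged
`10 * L`, and the splitting of a product is charged in addition for its position in the
boustrophedon order. -/
theorem UnambiguousAt.meanSteps_le [Finite T] {L : ℕ} (hL : 1 ≤ L) (d : ℕ) {A : g.NT} {m r : ℕ}
    (hmL : Nat.size m ≤ L) (hm : 0 < m) (h : g.UnambiguousAt A) (hA0 : 0 < g.count A m)
    (hr : ∀ s, g.IsParseTree s → s.root = A → s.yield.length = m → s.unitChain.length ≤ r) :
    meanSteps (g.generateFrom d A m) ≤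
      ((10 * L * (r + 2 * Fintype.card g.NT * (m - 1) + 2 * (m * Nat.size m)) : ℕ) : ℝ≥0∞) := by
  induction d generalizing A m r with
  | zero => simp [meanSteps_eq_expect, generateFrom, PMF.expect_pure]
  | succ d ih =>
    have hr1 : 1 ≤ r := by
      obtain ⟨w, ⟨s, hs, hroot, rfl⟩, hw⟩ := (count_pos_iff hm).1 hA0
      exact s.length_unitChain_pos.trans_le (hr s hs hroot hw)
    obtain ⟨r, rfl⟩ : ∃ r', r = r' + 1 := ⟨r - 1, by omega⟩
    have hcoin := expect_coinTest_readCost_le hmL hL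
    rw [meanSteps_eq_expect]
    rcases hA : g.rule A with ⟨B, C⟩ | ⟨B, C⟩ | t
    · rw [expect_generateFrom_prod hA]
      set N := Fintype.card g.NT with hN
      set f : ℕ → ℝ≥0∞ := fun i =>
        meanSteps (g.generateFrom d B i) + meanSteps (g.generateFrom d C (m - i)) with hf
      have hchain : ∀ {B : g.NT} {s}, g.UnambiguousAt B → g.IsParseTree s → s.root = B →
          s.unitChain.length ≤ N := by
        rintro B s hB hs rfl
        exact hB.length_unitChain_le hs
      have hpick := expect_pick_le (m := m) (κ := ((8 * L : ℕ) : ℝ≥0∞))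
        (ENNReal.natCast_ne_top _) hcoin
        (fun i => g.count B i * g.count C (m - i))
        ((10 * L * (2 * N * (m - 1) + 2 * (m * Nat.size m)) : ℕ) : ℝ≥0∞) (boustrophedon m) f
        (by
          rw [sum_map_boustrophedon]
          obtain ⟨i, hi, hpos⟩ := exists_count_pos_of_prod hA hm hA0
          exact hpos.trans_le (Finset.single_le_sum
            (f := fun i => g.count B i * g.count C (m - i)) (fun _ _ => Nat.zero_le _) hi))
        (by
          intro j hj hw
          generalize hi : (boustrophedon m)[j] = i at hw ⊢
          have hmem : i ∈ Finset.Ico 1 m := by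
            rw [← mem_boustrophedon, ← hi]
            exact List.getElem_mem hj
          rw [Finset.mem_Ico] at hmem
          have hgain := boustrophedon_gain hj hi
          have hB0 : 0 < g.count B i := Nat.pos_of_mul_pos_right hw
          have hC0 : 0 < g.count C (m - i) := Nat.pos_of_mul_pos_left hw
          obtain ⟨u, hu, -⟩ := (count_pos_iff hmem.1).1 hB0
          obtain ⟨v, hv, -⟩ := (count_pos_iff (by omega)).1 hC0
          have huB := h.prod_left hA hv
          have huC := h.prod_right hA hu
          have h1 := ih (r := N) ((Nat.size_le_size (by omega)).trans hmL) hmem.1 huB hB0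
            fun s hs hr _ => hchain huB hs hr
          have h2 := ih (r := N) ((Nat.size_le_size (by omega)).trans hmL) (by omega) huC hC0
            fun s hs hr _ => hchain huC hs hr
          refine (add_le_add_right (add_le_add h1 h2) _).trans ?_
          norm_cast
          have hlin : N + 2 * N * (i - 1) + (N + 2 * N * (m - i - 1)) = 2 * N * (m - 1) := by
            obtain ⟨i, rfl⟩ : ∃ i', i = i' + 1 := ⟨i - 1, by omega⟩
            obtain ⟨q, rfl⟩ : ∃ q, m = i + 1 + (q + 1) := ⟨m - (i + 1) - 1, by omega⟩
            simp only [Nat.add_sub_cancel, Nat.add_sub_cancel_left]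
            rw [show i + 1 + (q + 1) - 1 = i + q + 1 by omega]
            ring
          calc 8 * L * j + (10 * L * (N + 2 * N * (i - 1) + 2 * (i * Nat.size i)) +
                10 * L * (N + 2 * N * (m - i - 1) + 2 * ((m - i) * Nat.size (m - i))))
              ≤ 10 * L * j + (10 * L * (N + 2 * N * (i - 1) + 2 * (i * Nat.size i)) +
                10 * L * (N + 2 * N * (m - i - 1) + 2 * ((m - i) * Nat.size (m - i)))) := by
                gcongr
                omega
            _ = 10 * L * ((N + 2 * N * (i - 1) + (N + 2 * N * (m - i - 1))) +
                (2 * (i * Nat.size i) + 2 * ((m - i) * Nat.size (m - i)) + j)) := by ring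
            _ ≤ _ := by
                rw [hlin]
                gcongr)
      calc _ = (pick m (fun i => g.count B i * g.count C (m - i)) (boustrophedon m)).expect
            fun x => (Nat.size m : ℝ≥0∞) + ((x.2 : ℝ≥0∞) + f x.1) := by
            refine PMF.expect_congr _ fun x _ => ?_
            simp only [Nat.cast_add, PMF.expect_add, PMF.expect_const, hf, meanSteps_eq_expect]
            ring
        _ ≤ (L : ℝ≥0∞) + (((8 * L : ℕ) : ℝ≥0∞) +
            ((10 * L * (2 * N * (m - 1) + 2 * (m * Nat.size m)) : ℕ) : ℝ≥0∞)) := by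
            rw [PMF.expect_add, PMF.expect_const]
            exact add_le_add (by exact_mod_cast hmL) hpick
        _ ≤ _ := by
            norm_cast
            nlinarith [Nat.zero_le (L * r)]
    · rw [expect_generateFrom_union hA]
      set D : ℝ≥0∞ := ((10 * L * (r + 2 * Fintype.card g.NT * (m - 1) +
        2 * (m * Nat.size m)) : ℕ) : ℝ≥0∞) with hD
      have hunit : ∀ E : g.NT, (E = B ∨ E = C) → ∀ s, g.IsParseTree s → s.root = E →
          s.yield.length = m → s.unitChain.length ≤ r := by
        rintro E hE s hs rfl hy
        have := hr (.unit A s) ⟨⟨B, C, hA, hE⟩, hs⟩ rfl hy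
        simpa [ParseTree.unitChain] using this
      have hS : 0 < g.count B m + g.count C m := by
        obtain ⟨w, hw, rfl⟩ := (count_pos_iff hm).1 hA0
        rcases (hasTree_union_iff hA).1 hw with hB | hC
        · have := (count_pos_iff hm).2 ⟨w, hB, rfl⟩
          omega
        · have := (count_pos_iff hm).2 ⟨w, hC, rfl⟩
          omega
      calc _ = (coinTest (g.count B m) (g.count B m + g.count C m)).expect fun x =>
            (Nat.size m : ℝ≥0∞) + ((readCost m x.2 : ℝ≥0∞) +
              if x.1 then meanSteps (g.generateFrom d B m)
              else meanSteps (g.generateFrom d C m)) := by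
            refine PMF.expect_congr _ fun x _ => ?_
            simp only [Nat.cast_add, PMF.expect_add, PMF.expect_const, meanSteps_eq_expect,
              add_assoc]
            split_ifs <;> rfl
        _ ≤ (L : ℝ≥0∞) + (((8 * L : ℕ) : ℝ≥0∞) +
              ((g.count B m : ℝ≥0∞) / (g.count B m + g.count C m : ℕ) * D +
                (g.count C m : ℝ≥0∞) / (g.count B m + g.count C m : ℕ) * D)) := by
            rw [PMF.expect_add, PMF.expect_const, PMF.expect_add,
              expect_coinTest_ite hS (Nat.le_add_right _ _), Nat.add_sub_cancel_left]
            refine add_le_add (by exact_mod_cast hmL)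
              (add_le_add (hcoin _ _) (add_le_add ?_ ?_))
            · rcases Nat.eq_zero_or_pos (g.count B m) with h0 | h0
              · simp [h0]
              · gcongr
                exact ih hmL hm (h.union_left hA) h0 (hunit B (Or.inl rfl))
            · rcases Nat.eq_zero_or_pos (g.count C m) with h0 | h0
              · simp [h0]
              · gcongr
                exact ih hmL hm (h.union_right hA) h0 (hunit C (Or.inr rfl))
        _ = (L : ℝ≥0∞) + (((8 * L : ℕ) : ℝ≥0∞) + D) := by
            rw [← add_mul, ← ENNReal.add_div, ← Nat.cast_add, ENNReal.div_self
              (by exact_mod_cast hS.ne') (ENNReal.natCast_ne_top _), one_mul]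
        _ ≤ _ := by
            rw [hD]
            norm_cast
            nlinarith
    · rw [expect_generateFrom_term hA]
      norm_cast
      nlinarith [Nat.zero_le (L * r), Nat.zero_le (L * (2 * Fintype.card g.NT * (m - 1))),
        Nat.zero_le (L * (m * Nat.size m))]

end CNFGrammar

theorem Nat.size_le_mul_rpow {δ : ℝ} (hδ : 0 < δ) {n : ℕ} (hn : 0 < n) :
    (Nat.size n : ℝ) ≤ (1 + 2 / δ) * (n : ℝ) ^ δ := by
  have hn1 : (1 : ℝ) ≤ n := by exact_mod_cast hn
  have h1 := Nat.size_pos.2 hn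
  have h2 : 2 ^ (Nat.size n - 1) ≤ n := Nat.lt_size.1 (by omega)
  have h3 : ((Nat.size n - 1 : ℕ) : ℝ) * Real.log 2 ≤ Real.log n := by
    rw [← Real.log_pow]
    exact Real.log_le_log (by positivity) (by exact_mod_cast h2)
  have h4 : Real.log n ≤ (n : ℝ) ^ δ / δ := Real.log_le_rpow_div (by positivity) hδ
  have h5 := Real.log_two_gt_d9
  have h6 : (1 : ℝ) ≤ (n : ℝ) ^ δ := Real.one_le_rpow hn1 hδ.le
  have h7 : ((Nat.size n - 1 : ℕ) : ℝ) ≤ 2 * ((n : ℝ) ^ δ / δ) := by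
    nlinarith [Nat.cast_nonneg (α := ℝ) (Nat.size n - 1)]
  rw [Nat.cast_sub h1] at h7
  push_cast at h7
  calc (Nat.size n : ℝ) ≤ 1 + 2 * ((n : ℝ) ^ δ / δ) := by linarith
    _ ≤ (n : ℝ) ^ δ + 2 * ((n : ℝ) ^ δ / δ) := by linarith
    _ = _ := by ring

theorem CNFGrammar.Unambiguous.exists_meanSteps_le {T : Type*} [Finite T] {g : CNFGrammar T}
    (h : g.Unambiguous) {ε : ℝ} (hε : 0 < ε) :
    ∃ c : ℝ, ∀ n : ℕ, 0 < n → (sizeSlice g.language n).Nonempty →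
      meanSteps (g.generator n) ≤ ENNReal.ofReal (c * (n : ℝ) ^ (1 + ε)) := by
  set N := Fintype.card g.NT with hN
  -- the mean time is at most `20 * (N + 1) * n * L ^ 2`, and `L` is `O(n ^ (ε / 2))`
  refine ⟨20 * (N + 1) * (1 + 2 / (ε / 2)) ^ 2, fun n hn hne => ?_⟩
  have hL : 1 ≤ Nat.size n := Nat.size_pos.2 hn
  have hu : g.UnambiguousAt g.start := h
  have hmean := hu.meanSteps_le hL ((n + 1) * (N + 1)) le_rfl hn
    ((Set.ncard_pos (sizeSlice_finite _ _)).2 hne) (r := N) fun s hs hr _ =>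
      UnambiguousAt.length_unitChain_le (hr ▸ hu) hs
  refine hmean.trans ?_
  rw [← ENNReal.ofReal_natCast]
  refine ENNReal.ofReal_le_ofReal ?_
  have hnat : 10 * Nat.size n * (N + 2 * N * (n - 1) + 2 * (n * Nat.size n)) ≤
      20 * (N + 1) * n * Nat.size n ^ 2 := by
    have h1 : N + 2 * N * (n - 1) ≤ 2 * N * n := by
      obtain ⟨q, rfl⟩ : ∃ q, n = q + 1 := ⟨n - 1, by omega⟩
      rw [Nat.add_sub_cancel]
      nlinarith
    calc 10 * Nat.size n * (N + 2 * N * (n - 1) + 2 * (n * Nat.size n))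
        ≤ 10 * Nat.size n * (2 * N * n * Nat.size n + 2 * (n * Nat.size n)) := by
          gcongr
          exact h1.trans (Nat.le_mul_of_pos_right _ hL)
      _ = _ := by ring
  have hn0 : (0 : ℝ) < n := by exact_mod_cast hn
  calc ((10 * Nat.size n * (N + 2 * N * (n - 1) + 2 * (n * Nat.size n)) : ℕ) : ℝ)
      ≤ 20 * (N + 1) * n * (Nat.size n : ℝ) ^ 2 := by exact_mod_cast hnat
    _ ≤ 20 * (N + 1) * n * ((1 + 2 / (ε / 2)) * (n : ℝ) ^ (ε / 2)) ^ 2 := by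
        gcongr
        exact Nat.size_le_mul_rpow (by positivity) hn
    _ = _ := by
        rw [mul_pow, ← Real.rpow_natCast ((n : ℝ) ^ (ε / 2)), ← Real.rpow_mul hn0.le,
          Real.rpow_add hn0, Real.rpow_one]
        rw [show ε / 2 * ((2 : ℕ) : ℝ) = ε by push_cast; ring]
        ring

theorem mainTheorem2 {T : Type*} [Fintype T] :
    -- every unambiguous grammar, with the recursive generator
    (∀ g : CNFGrammar T, g.Unambiguous →
      (∀ n : ℕ, 0 < n → IsUniformGenerator (g.generator n) (sizeSlice g.language n)) ∧
      ∀ ε : ℝ, 0 < ε →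
        (∃ c : ℝ, ∀ n : ℕ, 0 < n → (sizeSlice g.language n).Nonempty →
          meanSteps (g.generator n) ≤ ENNReal.ofReal (c * (n : ℝ) ^ (1 + ε))) ∧
        ∃ K : ℝ, ∀ n : ℕ, 0 < n → ∀ F : Finset (List T), (F : Set (List T)) ⊆ sizeSlice g.language n →
          ∀ k : ℕ, 2 ≤ k → k + F.card ≤ (sizeSlice g.language n).ncard →
          rejectionCost (g.generator n) F k ≤ ENNReal.ofReal
            (K * (((sizeSlice g.language n).ncard : ℝ) /
                (((sizeSlice g.language n).ncard : ℝ) - (F.card : ℝ))) *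
              (n : ℝ) ^ (1 + ε) * ((k : ℝ) * Real.log (k : ℝ)))) ∧
    -- every context-free language, with any uniform generator of average time `O(n ^ (1 + ε))`
    (∀ L : Language T, L.IsContextFree → ∀ G : ℕ → PMF (Draw T),
      (∀ n : ℕ, 0 < n → IsUniformGenerator (G n) (sizeSlice L n)) →
      ∀ ε : ℝ, 0 < ε →
        (∃ c : ℝ, ∀ n : ℕ, 0 < n → (sizeSlice L n).Nonempty →
          meanSteps (G n) ≤ ENNReal.ofReal (c * (n : ℝ) ^ (1 + ε))) →
        ∃ K : ℝ, ∀ n : ℕ, 0 < n → ∀ F : Finset (List T), (F : Set (List T)) ⊆ sizeSlice L n →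
          ∀ k : ℕ, 2 ≤ k → k + F.card ≤ (sizeSlice L n).ncard →
          rejectionCost (G n) F k ≤ ENNReal.ofReal
            (K * (((sizeSlice L n).ncard : ℝ) /
                (((sizeSlice L n).ncard : ℝ) - (F.card : ℝ))) *
              (n : ℝ) ^ (1 + ε) * ((k : ℝ) * Real.log (k : ℝ)))) := by
  refine ⟨fun g hg => ⟨fun n hn => hg.isUniformGenerator hn, fun ε hε =>
    ⟨hg.exists_meanSteps_le hε, ?_⟩⟩, fun L _ G hG ε hε hmean =>
    exists_rejectionCost_le L G hG ε hε hmean⟩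
  exact exists_rejectionCost_le g.language g.generator (fun n hn => hg.isUniformGenerator hn) ε hε
    (hg.exists_meanSteps_le hε)
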